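/- Let $N\ge 1$ and $n\ge 0$ be integers, let $-\frac1{\sqrt2}<\lambda_1<\dots<\lambda_N<\frac1{\sqrt2}$ and $\mu_1,\dots,\mu_N<0$ be real numbers, and put $\nu_k=\sqrt{\frac12-\lambda_k^2}$. Let $S=\{\lambda\in\mathbb R:|\lambda|\ge \frac1{\sqrt2}\}$. For $\beta:\mathbb R\to\mathbb C$ and $\xi\in\mathbb R$ put $\lambda(\xi)=\sqrt{\xi^2+\frac12}$, $$c_1(\xi)=\beta(\lambda(\xi))+\beta(-\lambda(\xi)),\qquad c_2(\xi)=\frac{\beta(\lambda(\xi))-\beta(-\lambda(\xi))}{\lambda(\xi)},$$ and define $$F_1(z)=\frac1{2\pi}\int_{\mathbb R}c_1(\xi)e^{i\xi z}\,d\xi-\sum_{k=1}^N\mu_k\lambda_ke^{-\nu_kz},\qquad F_2(z)=\frac1{2\pi}\int_{\mathbb R}c_2(\xi)e^{i\xi z}\,d\xi-\sum_{k=1}^N\mu_ke^{-\nu_kz}.$$ There exists a constant $\epsilon_0>0$, depending only on $N$, $n$, $(\lambda_i)$ and $(\mu_i)$, such that for every $\beta$ with $\lambda\mapsto\lambda^{n+2}\beta(\lambda)\in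 L^\infty(S)$ and $\|\lambda^n\beta\|_{L^\infty(S)}\le\epsilon_0$ the following holds. For every $x\in\mathbb R$ the Marchenko system (for $y\ge x$) $$\begin{aligned}2\sqrt2\,\Psi_1(x,y)&=F_2(x+y)-\int_x^{+\infty}\bigl[\sqrt2\,\Psi_2(x,s)(F_1-iF_2')(s+y)+\Psi_1(x,s)F_2(s+y)\bigr]ds,\\ 2\sqrt2\,\Psi_2(x,y)&=\sqrt2\,(F_1+iF_2')(x+y)-\int_x^{+\infty}\bigl[\sqrt2\,\Psi_1(x,s)(F_1+iF_2')(s+y)+\Psi_2(x,s)F_2(s+y)\bigr]ds\end{aligned}$$ has a unique solution $\Psi(x,\cdot)=(\Psi_1(x,\cdot),\Psi_2(x,\cdot))\in (H^n(x,+\infty))^2$. Moreover, the function $\underline\Psi(x,p)=\Psi(x,x+p)$, $(x,p)\in\mathbb R\times\mathbb R^+$, belongs to $\mathcal C^k(\mathbb R,(H^{n-k}(\mathbb R^+))^2)$ for every integer $0\le k\le n-1$. -/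

import Mathlib

open MeasureTheory

namespace Marchenko

noncomputable section

/-- `v` is the weak derivative of `u` on the open half-line `(a, ∞)`: for every real
test function `φ ∈ C_c^∞((a, ∞))` one has `∫ φ' u = - ∫ φ v`. -/
def IsWeakDeriv (a : ℝ) (u v : Lp ℂ 2 (volume.restrict (Set.Ioi a))) : Prop :=
  ∀ φ : ℝ → ℝ, ContDiff ℝ (⊤ : ℕ∞) φ → HasCompactSupport φ → tsupport φ ⊆ Set.Ioi a →
    ∫ t in Set.Ioi a, deriv φ t • u t = - ∫ t in Set.Ioi a, φ t • v t

theorem integrable_test_smul {a : ℝ} {φ : ℝ → ℝ} (hφ : Continuous φ)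
    (hc : HasCompactSupport φ) (u : Lp ℂ 2 (volume.restrict (Set.Ioi a))) :
    Integrable (fun t => φ t • u t) (volume.restrict (Set.Ioi a)) :=
  memLp_one_iff_integrable.mp
    ((Lp.memLp u).smul (hφ.memLp_of_hasCompactSupport (p := 2) hc))

theorem IsWeakDeriv.add {a : ℝ} {u v u' v' : Lp ℂ 2 (volume.restrict (Set.Ioi a))}
    (h : IsWeakDeriv a u v) (h' : IsWeakDeriv a u' v') : IsWeakDeriv a (u + u') (v + v') := by
  intro φ hφ hc hs
  have hd : Continuous (deriv φ) := hφ.continuous_deriv (by simp)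
  have e1 : ∫ t in Set.Ioi a, deriv φ t • (u + u') t
      = (∫ t in Set.Ioi a, deriv φ t • u t) + ∫ t in Set.Ioi a, deriv φ t • u' t := by
    rw [← integral_add (integrable_test_smul hd hc.deriv u) (integrable_test_smul hd hc.deriv u')]
    refine integral_congr_ae ?_
    filter_upwards [Lp.coeFn_add u u'] with t ht
    rw [ht, Pi.add_apply, smul_add]
  have e2 : ∫ t in Set.Ioi a, φ t • (v + v') t
      = (∫ t in Set.Ioi a, φ t • v t) + ∫ t in Set.Ioi a, φ t • v' t := by
    rw [← integral_add (integrable_test_smul hφ.continuous hc v)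
      (integrable_test_smul hφ.continuous hc v')]
    refine integral_congr_ae ?_
    filter_upwards [Lp.coeFn_add v v'] with t ht
    rw [ht, Pi.add_apply, smul_add]
  rw [e1, e2, h φ hφ hc hs, h' φ hφ hc hs, neg_add]

theorem IsWeakDeriv.smul {a : ℝ} {u v : Lp ℂ 2 (volume.restrict (Set.Ioi a))} (c : ℂ)
    (h : IsWeakDeriv a u v) : IsWeakDeriv a (c • u) (c • v) := by
  intro φ hφ hc hs
  have e1 : ∫ t in Set.Ioi a, deriv φ t • (c • u) t = c • ∫ t in Set.Ioi a, deriv φ t • u t := by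
    rw [← integral_smul]
    refine integral_congr_ae ?_
    filter_upwards [Lp.coeFn_smul c u] with t ht
    rw [ht, Pi.smul_apply, smul_comm]
  have e2 : ∫ t in Set.Ioi a, φ t • (c • v) t = c • ∫ t in Set.Ioi a, φ t • v t := by
    rw [← integral_smul]
    refine integral_congr_ae ?_
    filter_upwards [Lp.coeFn_smul c v] with t ht
    rw [ht, Pi.smul_apply, smul_comm]
  rw [e1, e2, h φ hφ hc hs, smul_neg]

theorem IsWeakDeriv.zero (a : ℝ) : IsWeakDeriv a 0 0 := by
  intro φ _ _ _
  have h0 := Lp.coeFn_zero ℂ 2 (volume.restrict (Set.Ioi a))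
  have e1 : ∫ t in Set.Ioi a, deriv φ t • (0 : Lp ℂ 2 (volume.restrict (Set.Ioi a))) t = 0 := by
    refine integral_eq_zero_of_ae ?_
    filter_upwards [h0] with t ht
    rw [ht]
    simp
  have e2 : ∫ t in Set.Ioi a, φ t • (0 : Lp ℂ 2 (volume.restrict (Set.Ioi a))) t = 0 := by
    refine integral_eq_zero_of_ae ?_
    filter_upwards [h0] with t ht
    rw [ht]
    simp
  rw [e1, e2, neg_zero]

/-- The complex Sobolev space `H^m((a, ∞))`. An element is recorded as the tuple
`(u, u', …, u^(m))` of a function `u ∈ L²((a, ∞))` and its (unique) weak derivatives up to order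
`m`, all in `L²((a, ∞))`; the norm inherited from the ambient Hilbert sum is the usual
`(∑_{j ≤ m} ‖u^(j)‖²_{L²})^{1/2}`. -/
def SobolevH (m : ℕ) (a : ℝ) :
    Submodule ℂ (PiLp 2 fun _ : Fin (m + 1) => Lp ℂ 2 (volume.restrict (Set.Ioi a))) where
  carrier := {w | ∀ j : Fin m, IsWeakDeriv a (w j.castSucc) (w j.succ)}
  add_mem' := fun h h' j => (h j).add (h' j)
  zero_mem' := fun _ => IsWeakDeriv.zero a
  smul_mem' := fun c _ h j => (h j).smul c

/-- The function (defined almost everywhere on `(a, ∞)`) underlying an element of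
`H^m((a, ∞))`. -/
def SobolevH.fn {m : ℕ} {a : ℝ} (u : SobolevH m a) : ℝ → ℂ :=
  ((u : PiLp 2 fun _ : Fin (m + 1) => Lp ℂ 2 (volume.restrict (Set.Ioi a))) 0 :
    Lp ℂ 2 (volume.restrict (Set.Ioi a)))

/-- `λ(ξ) = √(ξ² + 1/2)`. -/
def lamOf (ξ : ℝ) : ℝ := √(ξ ^ 2 + 1 / 2)

/-- `c₁(ξ) = β(λ(ξ)) + β(-λ(ξ))`. -/
def c₁ (β : ℝ → ℂ) (ξ : ℝ) : ℂ := β (lamOf ξ) + β (-lamOf ξ)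

/-- `c₂(ξ) = (β(λ(ξ)) - β(-λ(ξ))) / λ(ξ)`. -/
def c₂ (β : ℝ → ℂ) (ξ : ℝ) : ℂ := (β (lamOf ξ) - β (-lamOf ξ)) / (lamOf ξ : ℂ)

/-- `ν = √(1/2 - l²)`. -/
def nuOf (l : ℝ) : ℝ := √(1 / 2 - l ^ 2)

/-- `F₁₁(z) = ∑ₖ μₖ λₖ exp(-νₖ z)`. -/
def F₁₁ {N : ℕ} (lam mu : Fin N → ℝ) (z : ℝ) : ℂ :=
  ((∑ k, mu k * lam k * Real.exp (-nuOf (lam k) * z) : ℝ) : ℂ)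

/-- `F₂₁(z) = ∑ₖ μₖ exp(-νₖ z)`. -/
def F₂₁ {N : ℕ} (lam mu : Fin N → ℝ) (z : ℝ) : ℂ :=
  ((∑ k, mu k * Real.exp (-nuOf (lam k) * z) : ℝ) : ℂ)

/-- `F₁₂(z) = (1/2π) ∫ c₁(ξ) exp(i ξ z) dξ`. -/
def F₁₂ (β : ℝ → ℂ) (z : ℝ) : ℂ :=
  1 / (2 * (Real.pi : ℂ)) * ∫ ξ : ℝ, c₁ β ξ * Complex.exp (Complex.I * ξ * z)

/-- `F₂₂(z) = (1/2π) ∫ c₂(ξ) exp(i ξ z) dξ`. -/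
def F₂₂ (β : ℝ → ℂ) (z : ℝ) : ℂ :=
  1 / (2 * (Real.pi : ℂ)) * ∫ ξ : ℝ, c₂ β ξ * Complex.exp (Complex.I * ξ * z)

/-- `F₁ = F₁₂ - F₁₁`. -/
def F₁ {N : ℕ} (lam mu : Fin N → ℝ) (β : ℝ → ℂ) (z : ℝ) : ℂ := F₁₂ β z - F₁₁ lam mu z

/-- `F₂ = F₂₂ - F₂₁`. -/
def F₂ {N : ℕ} (lam mu : Fin N → ℝ) (β : ℝ → ℂ) (z : ℝ) : ℂ := F₂₂ β z - F₂₁ lam mu z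

/-- `F₁ + i F₂'`. -/
def Kplus {N : ℕ} (lam mu : Fin N → ℝ) (β : ℝ → ℂ) (z : ℝ) : ℂ :=
  F₁ lam mu β z + Complex.I * deriv (F₂ lam mu β) z

/-- `F₁ - i F₂'`. -/
def Kminus {N : ℕ} (lam mu : Fin N → ℝ) (β : ℝ → ℂ) (z : ℝ) : ℂ :=
  F₁ lam mu β z - Complex.I * deriv (F₂ lam mu β) z

/-- `(Ψ₁, Ψ₂)` solves the Marchenko system with parameter `x`: for almost every `y > x`, both
integrals converge absolutely and both equations hold. -/
def IsMarchenkoSolution {N : ℕ} (lam mu : Fin N → ℝ) (β : ℝ → ℂ) (x : ℝ) (Ψ₁ Ψ₂ : ℝ → ℂ) : Prop :=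
  ∀ᵐ y ∂(volume.restrict (Set.Ioi x)),
    IntegrableOn (fun s => (√2 : ℂ) * Ψ₂ s * Kminus lam mu β (s + y)
      + Ψ₁ s * F₂ lam mu β (s + y)) (Set.Ioi x) ∧
    IntegrableOn (fun s => (√2 : ℂ) * Ψ₁ s * Kplus lam mu β (s + y)
      + Ψ₂ s * F₂ lam mu β (s + y)) (Set.Ioi x) ∧
    2 * (√2 : ℂ) * Ψ₁ y = F₂ lam mu β (x + y)
      - ∫ s in Set.Ioi x, ((√2 : ℂ) * Ψ₂ s * Kminus lam mu β (s + y)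
          + Ψ₁ s * F₂ lam mu β (s + y)) ∧
    2 * (√2 : ℂ) * Ψ₂ y = (√2 : ℂ) * Kplus lam mu β (x + y)
      - ∫ s in Set.Ioi x, ((√2 : ℂ) * Ψ₁ s * Kplus lam mu β (s + y)
          + Ψ₂ s * F₂ lam mu β (s + y))

/-- Lebesgue measure on `{l : |l| ≥ 1/√2}`, the set of all values `±λ(ξ)`, `ξ ∈ ℝ`. -/
def spectralMeasure : Measure ℝ := volume.restrict {l : ℝ | 1 / √2 ≤ |l|}

end

end Marchenko

namespace Marchenko

open scoped FourierTransform ComplexInnerProductSpace ContDiff SchwartzMap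

/-! ### The Fourier transform of square integrable functions -/

/-! Put y = x + p and s = x + q. For each x the system becomes an equation (2√2 + T_x)Φ = b_x in
L²(0,∞)², where T_x is a block Hankel operator: its kernels depend on p + q only and are shifted by
2x. Each kernel is an inverse Fourier transform plus a finite sum of exponentials, and the two parts
are controlled differently.

The Fourier part with symbol c is restriction ∘ 𝓕⁻ ∘ (multiplication by c) ∘ 𝓕⁻ ∘ extension by zero,
so its norm is at most ‖c‖_∞ (`norm_hankel_apply_le`). The shift by 2x only multiplies the symbol by
a phase, so this bound is uniform in x. The smallness of λⁿβ makes all four symbols at most 1/4. The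
exponential part need not be small, but it is positive semidefinite (`re_expOp_block_nonneg`): its
weights -μₖ are positive, and θₖ = √2(λₖ + iνₖ) has modulus one, so the k-th term of its quadratic
form is a nonnegative multiple of |a + θₖ b|². Thus 2√2 + T_x is coercive, hence invertible, for
every x (`isUnit_marchenkoOp`). Existence and uniqueness are therefore settled in L².

Regularity comes from the kernels alone. A derivative in p multiplies a symbol by 2πiη and a
derivative in x multiplies it by 4πiη, while the decay λ^(-(n+2)) pays for n such factors and leaves
what is needed for integrability and continuity (`contDiff_phaseLp`, `SymbolDecay`). Inversion is
smooth on invertible operators, so x ↦ Φ(x) is C^k in L². Solving the equation for the term 2√2 Φ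
puts every p-derivative on a kernel and none on Φ, so the derivatives of order j are C^k curves in
L² whenever j + k ≤ n (`exists_sobolev_solution`). -/

theorem integral_smul_fourier_toLp (u : Lp ℂ 2 (volume : Measure ℝ)) (φ : 𝓢(ℝ, ℂ)) :
    ∫ x, φ x • (𝓕 u : Lp ℂ 2 (volume : Measure ℝ)) x = ∫ x, 𝓕 (φ : ℝ → ℂ) x • u x := by
  rw [← Lp.toTemperedDistribution_apply, ← Lp.fourier_toTemperedDistribution_eq,
    TemperedDistribution.fourier_apply, Lp.toTemperedDistribution_apply, SchwartzMap.fourier_coe]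

theorem integral_smul_fourierInv_toLp (u : Lp ℂ 2 (volume : Measure ℝ)) (φ : 𝓢(ℝ, ℂ)) :
    ∫ x, φ x • (𝓕⁻ u : Lp ℂ 2 (volume : Measure ℝ)) x = ∫ x, 𝓕⁻ (φ : ℝ → ℂ) x • u x := by
  rw [← Lp.toTemperedDistribution_apply, ← Lp.fourierInv_toTemperedDistribution_eq,
    TemperedDistribution.fourierInv_apply, Lp.toTemperedDistribution_apply,
    SchwartzMap.fourierInv_coe]

/-- A real test function as a complex Schwartz function. -/
noncomputable def testSchwartz (φ : ℝ → ℝ) (h : ContDiff ℝ ∞ φ) (hc : HasCompactSupport φ) :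
    𝓢(ℝ, ℂ) :=
  HasCompactSupport.toSchwartzMap (f := Complex.ofRealCLM ∘ φ) (hc.comp_left rfl) (by fun_prop)

@[simp]
theorem testSchwartz_apply (φ : ℝ → ℝ) (h : ContDiff ℝ ∞ φ) (hc : HasCompactSupport φ) (x : ℝ) :
    testSchwartz φ h hc x = φ x := by
  simp [testSchwartz]

theorem fourierInv_real_eq_fourier_neg (f : ℝ → ℂ) (x : ℝ) : 𝓕⁻ f x = 𝓕 f (-x) :=
  Real.fourierInv_eq_fourier_neg f x

theorem continuous_fourier_of_integrable {f : ℝ → ℂ} (hf : Integrable f) :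
    Continuous (𝓕 f) :=
  VectorFourier.fourierIntegral_continuous Real.continuous_fourierChar
    (L := innerₗ ℝ) (by exact continuous_inner) hf

theorem continuous_fourierInv_of_integrable {f : ℝ → ℂ} (hf : Integrable f) :
    Continuous (𝓕⁻ f) := by
  have : 𝓕⁻ f = fun x => 𝓕 f (-x) := by ext x; exact fourierInv_real_eq_fourier_neg f x
  rw [this]
  exact (continuous_fourier_of_integrable hf).comp continuous_neg

/-- On L¹ ∩ L² both transforms have the same pairing with every smooth compactly supported function:
one by its description as a tempered distribution, the other by Fubini. -/
theorem fourier_toLp_ae {f : ℝ → ℂ} (hf : Integrable f) (hf2 : MemLp f 2 volume) :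
    (𝓕 (hf2.toLp f) : Lp ℂ 2 (volume : Measure ℝ)) =ᵐ[volume] 𝓕 f := by
  refine ae_eq_of_integral_contDiff_smul_eq ((Lp.memLp _).locallyIntegrable (by norm_num))
    ((continuous_fourier_of_integrable hf).locallyIntegrable) fun g hg hgc => ?_
  have key := integral_smul_fourier_toLp (hf2.toLp f) (testSchwartz g hg hgc)
  have e := VectorFourier.integral_fourierIntegral_smul_eq_flip (L := innerₗ ℝ) (μ := volume)
    (ν := volume) (e := Real.fourierChar) (f := (testSchwartz g hg hgc : ℝ → ℂ)) (g := f)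
    Real.continuous_fourierChar continuous_inner (SchwartzMap.integrable _) hf
  simp only [testSchwartz_apply] at key
  calc ∫ x, g x • (𝓕 (hf2.toLp f) : Lp ℂ 2 (volume : Measure ℝ)) x
      = ∫ x, (g x : ℂ) • (𝓕 (hf2.toLp f) : Lp ℂ 2 (volume : Measure ℝ)) x := by
        simp only [Complex.coe_smul]
    _ = ∫ x, 𝓕 (testSchwartz g hg hgc : ℝ → ℂ) x • f x := by
        rw [key]
        refine integral_congr_ae ?_
        filter_upwards [hf2.coeFn_toLp] with x hx
        rw [hx]
    _ = ∫ x, g x • 𝓕 f x := by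
        refine e.trans ?_
        simp only [flip_innerₗ, testSchwartz_apply, Complex.coe_smul]
        rfl

theorem fourierInv_toLp_ae {f : ℝ → ℂ} (hf : Integrable f) (hf2 : MemLp f 2 volume) :
    (𝓕⁻ (hf2.toLp f) : Lp ℂ 2 (volume : Measure ℝ)) =ᵐ[volume] 𝓕⁻ f := by
  refine ae_eq_of_integral_contDiff_smul_eq ((Lp.memLp _).locallyIntegrable (by norm_num))
    (continuous_fourierInv_of_integrable hf).locallyIntegrable fun g hg hgc => ?_
  have key := integral_smul_fourierInv_toLp (hf2.toLp f) (testSchwartz g hg hgc)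
  have e := VectorFourier.integral_fourierIntegral_smul_eq_flip (L := -innerₗ ℝ) (μ := volume)
    (ν := volume) (e := Real.fourierChar) (f := (testSchwartz g hg hgc : ℝ → ℂ)) (g := f)
    Real.continuous_fourierChar (by exact continuous_inner.neg) (SchwartzMap.integrable _) hf
  simp only [testSchwartz_apply] at key
  calc ∫ x, g x • (𝓕⁻ (hf2.toLp f) : Lp ℂ 2 (volume : Measure ℝ)) x
      = ∫ x, (g x : ℂ) • (𝓕⁻ (hf2.toLp f) : Lp ℂ 2 (volume : Measure ℝ)) x := by
        simp only [Complex.coe_smul]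
    _ = ∫ x, 𝓕⁻ (testSchwartz g hg hgc : ℝ → ℂ) x • f x := by
        rw [key]
        refine integral_congr_ae ?_
        filter_upwards [hf2.coeFn_toLp] with x hx
        rw [hx]
    _ = ∫ x, g x • 𝓕⁻ f x := by
        refine e.trans ?_
        have : (-innerₗ ℝ : ℝ →ₗ[ℝ] ℝ →ₗ[ℝ] ℝ).flip = -innerₗ ℝ := by
          ext; simp
        simp only [this, testSchwartz_apply, Complex.coe_smul]
        rfl

theorem hasDerivAt_fourierInv {f : ℝ → ℂ} (hf : Integrable f)
    (hf' : Integrable (fun η : ℝ => 2 * Real.pi * Complex.I * η * f η)) (w : ℝ) :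
    HasDerivAt (𝓕⁻ f) (𝓕⁻ (fun η : ℝ => 2 * Real.pi * Complex.I * η * f η) w) w := by
  have hm : Integrable (fun x : ℝ => x • f x) := by
    refine (hf'.const_mul (2 * Real.pi * Complex.I)⁻¹).congr (.of_forall fun x => ?_)
    simp only [Complex.real_smul]
    field_simp
  have h := (Real.hasDerivAt_fourier hf hm (-w)).scomp w (hasDerivAt_neg w)
  have e : 𝓕⁻ f = 𝓕 f ∘ Neg.neg := by ext x; exact fourierInv_real_eq_fourier_neg f x
  rw [e, fourierInv_real_eq_fourier_neg]
  convert! h using 1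
  rw [neg_smul, one_smul]
  have : (fun x : ℝ => (-2 * (Real.pi : ℂ) * Complex.I * x) • f x)
      = (fun η : ℝ => (-1 : ℂ) • (2 * Real.pi * Complex.I * η * f η)) := by
    ext; simp
  rw [this]
  have := Real.fourier_eq (fun η : ℝ => (-1 : ℂ) • (2 * Real.pi * Complex.I * η * f η)) (-w)
  rw [this, Real.fourier_eq]
  simp [integral_neg]

theorem fourierInv_deriv_testSchwartz (φ : ℝ → ℝ) (h : ContDiff ℝ ∞ φ) (hc : HasCompactSupport φ)
    (h' : ContDiff ℝ ∞ (deriv φ)) (hc' : HasCompactSupport (deriv φ)) (η : ℝ) :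
    𝓕⁻ (testSchwartz (deriv φ) h' hc' : ℝ → ℂ) η
      = -(2 * Real.pi * Complex.I * η) * 𝓕⁻ (testSchwartz φ h hc : ℝ → ℂ) η := by
  have e : (testSchwartz (deriv φ) h' hc' : ℝ → ℂ) = deriv (testSchwartz φ h hc : ℝ → ℂ) := by
    ext x
    have h1 : HasDerivAt φ (deriv φ x) x := (h.differentiable (by simp) x).hasDerivAt
    have h2 : (testSchwartz φ h hc : ℝ → ℂ) = fun y => (φ y : ℂ) := by ext; simp
    rw [h2, h1.ofReal_comp.deriv, testSchwartz_apply]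
  have hd : Integrable (deriv (testSchwartz φ h hc : ℝ → ℂ)) := by
    rw [← e]; exact SchwartzMap.integrable _
  rw [fourierInv_real_eq_fourier_neg, fourierInv_real_eq_fourier_neg, e,
    Real.fourier_deriv (SchwartzMap.integrable _) (SchwartzMap.differentiable _) hd]
  simp

/-- Restriction of square integrable functions to the positive half-line. -/
noncomputable abbrev restrictHalf : Lp ℂ 2 (volume : Measure ℝ) →L[ℂ]
    Lp ℂ 2 (volume.restrict (Set.Ioi (0 : ℝ))) :=
  LpToLpRestrictCLM ℝ ℂ ℂ volume 2 (Set.Ioi 0)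

theorem setIntegral_testSchwartz_smul_restrictHalf {φ : ℝ → ℝ} (h : ContDiff ℝ ∞ φ)
    (hc : HasCompactSupport φ) (hs : tsupport φ ⊆ Set.Ioi 0) (u : Lp ℂ 2 (volume : Measure ℝ)) :
    ∫ t in Set.Ioi 0, φ t • restrictHalf u t = ∫ t, testSchwartz φ h hc t • u t := by
  calc ∫ t in Set.Ioi 0, φ t • restrictHalf u t = ∫ t in Set.Ioi 0, φ t • u t := by
        refine integral_congr_ae ?_
        filter_upwards [LpToLpRestrictCLM_coeFn ℂ (Set.Ioi (0 : ℝ)) u] with t ht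
        rw [ht]
    _ = ∫ t, φ t • u t := by
        refine setIntegral_eq_integral_of_forall_compl_eq_zero fun t ht => ?_
        rw [image_eq_zero_of_notMem_tsupport (fun h => ht (hs h)), zero_smul]
    _ = _ := by simp

/-- A test function supported in the open half-line turns the pairing there into one on the whole
line. It can then be moved to the Fourier side, where the derivative is a multiplication. -/
theorem isWeakDeriv_restrictHalf_fourierInv {g h : Lp ℂ 2 (volume : Measure ℝ)}
    (hgh : ∀ᵐ η : ℝ, h η = 2 * Real.pi * Complex.I * η * g η) :
    IsWeakDeriv 0 (restrictHalf (𝓕⁻ g)) (restrictHalf (𝓕⁻ h)) := by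
  intro φ hφ hc hs
  have hφ' : ContDiff ℝ ∞ (deriv φ) := ((contDiff_infty_iff_deriv).1 hφ).2
  rw [setIntegral_testSchwartz_smul_restrictHalf hφ hc hs,
    setIntegral_testSchwartz_smul_restrictHalf hφ' hc.deriv ((tsupport_deriv_subset).trans hs),
    integral_smul_fourierInv_toLp, integral_smul_fourierInv_toLp, ← integral_neg]
  refine integral_congr_ae ?_
  filter_upwards [hgh] with η hη
  rw [hη, fourierInv_deriv_testSchwartz φ hφ hc]
  simp
  ring

/-! ### Hankel operators with Fourier symbols -/

/-- Square integrable functions on the positive half-line. -/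
abbrev HalfL2 : Type := Lp ℂ 2 (volume.restrict (Set.Ioi (0 : ℝ)))

/-- The inverse Fourier transform on `L²(ℝ)` as a continuous linear map. -/
noncomputable def fourierInvL2 : Lp ℂ 2 (volume : Measure ℝ) →L[ℂ] Lp ℂ 2 (volume : Measure ℝ) :=
  (Lp.fourierTransformₗᵢ ℝ ℂ).symm.toContinuousLinearEquiv.toContinuousLinearMap

theorem fourierInvL2_apply (u : Lp ℂ 2 (volume : Measure ℝ)) : fourierInvL2 u = 𝓕⁻ u := rfl

theorem norm_fourierInvL2_apply (u : Lp ℂ 2 (volume : Measure ℝ)) : ‖fourierInvL2 u‖ = ‖u‖ :=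
  (Lp.fourierTransformₗᵢ ℝ ℂ).symm.norm_map u

/-- Multiplication of square integrable functions by bounded ones. -/
noncomputable def mulL2 : Lp ℂ ⊤ (volume : Measure ℝ) →L[ℂ] Lp ℂ 2 (volume : Measure ℝ) →L[ℂ]
    Lp ℂ 2 (volume : Measure ℝ) :=
  (ContinuousLinearMap.mul ℂ ℂ).holderL volume ⊤ 2 2

theorem mulL2_ae (c : Lp ℂ ⊤ (volume : Measure ℝ)) (u : Lp ℂ 2 (volume : Measure ℝ)) :
    mulL2 c u =ᵐ[volume] fun η => c η * u η :=
  (ContinuousLinearMap.mul ℂ ℂ).coeFn_holder (r := 2) c u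

theorem norm_mulL2_apply_le (c : Lp ℂ ⊤ (volume : Measure ℝ))
    (u : Lp ℂ 2 (volume : Measure ℝ)) : ‖mulL2 c u‖ ≤ ‖c‖ * ‖u‖ := by
  have h := (ContinuousLinearMap.mul ℂ ℂ).norm_holder_apply_apply_le (r := 2) c u
  rw [mul_assoc] at h
  refine h.trans (mul_le_of_le_one_left (by positivity) (ContinuousLinearMap.opNorm_mul_le ℂ ℂ))

/-- The Hankel operator on the half-line whose kernel is the inverse Fourier transform of a
bounded symbol. -/
noncomputable def hankel : Lp ℂ ⊤ (volume : Measure ℝ) →L[ℂ] HalfL2 →L[ℂ] HalfL2 :=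
  ContinuousLinearMap.compL ℂ HalfL2 (Lp ℂ 2 (volume : Measure ℝ)) HalfL2
      (restrictHalf ∘L fourierInvL2) ∘L
    (ContinuousLinearMap.compL ℂ HalfL2 (Lp ℂ 2 (volume : Measure ℝ))
      (Lp ℂ 2 (volume : Measure ℝ))).flip
      (fourierInvL2 ∘L ContinuousLinearMap.adjoint restrictHalf) ∘L mulL2

theorem hankel_apply (c : Lp ℂ ⊤ (volume : Measure ℝ)) (ψ : HalfL2) :
    hankel c ψ = restrictHalf (𝓕⁻ (mulL2 c (𝓕⁻ (ContinuousLinearMap.adjoint restrictHalf ψ)))) :=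
  rfl

theorem norm_restrictHalf_le : ‖restrictHalf‖ ≤ 1 :=
  ContinuousLinearMap.opNorm_le_bound _ zero_le_one fun u => by
    rw [one_mul]; exact norm_Lp_toLp_restrict_le (Set.Ioi (0 : ℝ)) u

/-- Restriction and its adjoint, extension by zero, are contractions and 𝓕⁻ is an isometry, so only
the multiplication contributes. Using 𝓕⁻ on both sides of it, instead of 𝓕 on one, is what makes the
kernel depend on p + q. -/
theorem norm_hankel_apply_le (c : Lp ℂ ⊤ (volume : Measure ℝ)) (ψ : HalfL2) :
    ‖hankel c ψ‖ ≤ ‖c‖ * ‖ψ‖ := by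
  rw [hankel_apply, ← fourierInvL2_apply, ← fourierInvL2_apply]
  refine (ContinuousLinearMap.le_of_opNorm_le _ norm_restrictHalf_le _).trans ?_
  rw [one_mul, norm_fourierInvL2_apply]
  refine (norm_mulL2_apply_le _ _).trans ?_
  rw [norm_fourierInvL2_apply]
  gcongr
  have h : ‖ContinuousLinearMap.adjoint restrictHalf‖ ≤ 1 := by
    rw [LinearIsometryEquiv.norm_map]; exact norm_restrictHalf_le
  simpa using ContinuousLinearMap.le_of_opNorm_le _ h ψ

theorem memLp_fourierInv {c : ℝ → ℂ} (hc : Integrable c) (hc2 : MemLp c 2 volume) :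
    MemLp (𝓕⁻ c) 2 volume :=
  (memLp_congr_ae (fourierInv_toLp_ae hc hc2)).1 (Lp.memLp _)

theorem isWeakDeriv_hankel {c d : Lp ℂ ⊤ (volume : Measure ℝ)}
    (hcd : ∀ᵐ η : ℝ, d η = 2 * Real.pi * Complex.I * η * c η) (ψ : HalfL2) :
    IsWeakDeriv 0 (hankel c ψ) (hankel d ψ) := by
  rw [hankel_apply, hankel_apply]
  refine isWeakDeriv_restrictHalf_fourierInv ?_
  filter_upwards [hcd, mulL2_ae c (𝓕⁻ (ContinuousLinearMap.adjoint restrictHalf ψ)),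
    mulL2_ae d (𝓕⁻ (ContinuousLinearMap.adjoint restrictHalf ψ))] with η h1 h2 h3
  rw [h2, h3, h1]
  ring

/-- The value at p is an inner product with the conjugate of the symbol modulated by p. Parseval
removes the inner transform from ψ and turns the modulation into the shift by p. -/
theorem fourierInv_mul_fourierInv_adjoint {c : ℝ → ℂ} (hc : Integrable c)
    (hc2 : MemLp c 2 volume) (ψ : HalfL2) (p : ℝ) :
    𝓕⁻ (fun η => c η * (𝓕⁻ (ContinuousLinearMap.adjoint restrictHalf ψ) :
        Lp ℂ 2 (volume : Measure ℝ)) η) p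
      = ∫ q in Set.Ioi 0, ψ q * 𝓕⁻ c (p + q) := by
  set w : Lp ℂ 2 (volume : Measure ℝ) := 𝓕⁻ (ContinuousLinearMap.adjoint restrictHalf ψ) with hw
  let f : ℝ → ℂ := fun v => (starRingEnd ℂ) (Real.fourierChar (v * p) * c v)
  have hmeas : AEStronglyMeasurable f volume := by
    have : Continuous fun v : ℝ => (Real.fourierChar (v * p) : ℂ) := by
      have := Real.continuous_fourierChar
      fun_prop
    exact Complex.continuous_conj.comp_aestronglyMeasurable
      (this.aestronglyMeasurable.mul hc.aestronglyMeasurable)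
  have hnorm : ∀ v, ‖f v‖ = ‖c v‖ := by intro v; simp only [f, RCLike.norm_conj, norm_mul, Circle.norm_coe, one_mul]
  have hf1 : Integrable f := hc.mono hmeas (.of_forall fun v => (hnorm v).le)
  have hf2 : MemLp f 2 volume := hc2.mono hmeas (.of_forall fun v => (hnorm v).le)
  have hF : ∀ q, 𝓕 f q = (starRingEnd ℂ) (𝓕⁻ c (p + q)) := by
    intro q
    rw [Real.fourier_eq, Real.fourierInv_eq, ← integral_conj]
    refine integral_congr_ae (.of_forall fun v => ?_)
    simp only [f, Circle.smul_def, smul_eq_mul, map_mul]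
    rw [← mul_assoc]
    congr 1
    rw [← Circle.coe_inv_eq_conj, ← Circle.coe_inv_eq_conj, ← Circle.coe_mul, ← AddChar.map_neg_eq_inv,
      ← AddChar.map_neg_eq_inv, ← AddChar.map_add_eq_mul]
    congr 2
    simp
    ring
  have h1 : 𝓕⁻ (fun η => c η * w η) p = ⟪hf2.toLp f, w⟫ := by
    rw [Real.fourierInv_eq, L2.inner_def]
    refine integral_congr_ae ?_
    filter_upwards [hf2.coeFn_toLp] with v hv
    rw [hv]
    simp [f, Circle.smul_def]
    rw [mul_comm p v]
    ring
  have h2 : ⟪hf2.toLp f, w⟫ = ⟪restrictHalf (𝓕 (hf2.toLp f)), ψ⟫ := by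
    rw [← ContinuousLinearMap.adjoint_inner_right, ← Lp.inner_fourier_eq, hw,
      FourierTransform.fourier_fourierInv_eq]
  rw [h1, h2, L2.inner_def]
  refine integral_congr_ae ?_
  filter_upwards [LpToLpRestrictCLM_coeFn ℂ (Set.Ioi (0 : ℝ)) (𝓕 (hf2.toLp f)),
    ae_restrict_of_ae (fourier_toLp_ae hf1 hf2)] with q hq hq'
  rw [hq, hq', hF]
  simp

theorem hankel_apply_ae {c : ℝ → ℂ} (hc : Integrable c) (hc2 : MemLp c 2 volume)
    (hcT : MemLp c ⊤ volume) (ψ : HalfL2) :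
    hankel (hcT.toLp c) ψ =ᵐ[volume.restrict (Set.Ioi 0)]
      fun p => ∫ q in Set.Ioi 0, ψ q * 𝓕⁻ c (p + q) := by
  set w : Lp ℂ 2 (volume : Measure ℝ) := 𝓕⁻ (ContinuousLinearMap.adjoint restrictHalf ψ) with hw
  have hprod : mulL2 (hcT.toLp c) w =ᵐ[volume] fun η => c η * w η := by
    filter_upwards [mulL2_ae (hcT.toLp c) w, hcT.coeFn_toLp] with η h1 h2
    rw [h1, h2]
  have hm2 : MemLp (fun η => c η * w η) 2 volume := (memLp_congr_ae hprod).1 (Lp.memLp _)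
  have hm1 : Integrable (fun η => c η * w η) := hc2.integrable_mul (Lp.memLp w)
  have he : mulL2 (hcT.toLp c) w = hm2.toLp _ := by
    refine Lp.ext ?_
    filter_upwards [hprod, hm2.coeFn_toLp] with η h1 h2
    rw [h1, h2]
  rw [hankel_apply, ← hw, he]
  filter_upwards [LpToLpRestrictCLM_coeFn ℂ (Set.Ioi (0 : ℝ)) (𝓕⁻ (hm2.toLp _)),
    ae_restrict_of_ae (fourierInv_toLp_ae hm1 hm2)] with p h1 h2
  rw [h1, h2]
  exact fourierInv_mul_fourierInv_adjoint hc hc2 ψ p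

/-! ### Modulated symbols -/

/-- The symbol of the translate by `2 x` of the kernel with symbol `g`. -/
noncomputable def phase (g : ℝ → ℂ) (x : ℝ) (η : ℝ) : ℂ :=
  Complex.exp (Complex.I * ((4 * Real.pi * x * η : ℝ) : ℂ)) * g η

theorem norm_phase (g : ℝ → ℂ) (x η : ℝ) : ‖phase g x η‖ = ‖g η‖ := by
  rw [phase, norm_mul, mul_comm Complex.I, Complex.norm_exp_ofReal_mul_I, one_mul]

theorem aestronglyMeasurable_phase {g : ℝ → ℂ} (hg : AEStronglyMeasurable g volume) (x : ℝ) :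
    AEStronglyMeasurable (phase g x) volume := by
  have : Continuous fun η : ℝ => Complex.exp (Complex.I * ((4 * Real.pi * x * η : ℝ) : ℂ)) := by
    fun_prop
  exact this.aestronglyMeasurable.mul hg

theorem memLp_phase {p : ENNReal} {g : ℝ → ℂ} (hg : MemLp g p volume) (x : ℝ) :
    MemLp (phase g x) p volume :=
  hg.mono (aestronglyMeasurable_phase hg.1 x) (.of_forall fun η => (norm_phase g x η).le)

theorem integrable_phase {g : ℝ → ℂ} (hg : Integrable g) (x : ℝ) : Integrable (phase g x) :=
  hg.mono (aestronglyMeasurable_phase hg.1 x) (.of_forall fun η => (norm_phase g x η).le)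

theorem fourierInv_phase (g : ℝ → ℂ) (x z : ℝ) : 𝓕⁻ (phase g x) z = 𝓕⁻ g (2 * x + z) := by
  rw [Real.fourierInv_eq', Real.fourierInv_eq']
  refine integral_congr_ae (.of_forall fun v => ?_)
  simp only [phase, smul_eq_mul]
  rw [← mul_assoc, ← Complex.exp_add]
  congr 2
  simp
  ring

/-- The curve of modulated symbols in `Lᵖ`. -/
noncomputable def phaseLp {p : ENNReal} {g : ℝ → ℂ} (hg : MemLp g p volume) (x : ℝ) :
    Lp ℂ p (volume : Measure ℝ) := (memLp_phase hg x).toLp _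

theorem phaseLp_ae {p : ENNReal} {g : ℝ → ℂ} (hg : MemLp g p volume) (x : ℝ) :
    phaseLp hg x =ᵐ[volume] phase g x := (memLp_phase hg x).coeFn_toLp

theorem norm_exp_I_sub_one_sub_le (t : ℝ) :
    ‖Complex.exp (Complex.I * t) - 1 - Complex.I * t‖ ≤ 2 * t ^ 2 := by
  have hn : ‖Complex.I * (t : ℂ)‖ = |t| := by simp
  rcases le_or_gt |t| 1 with h | h
  · refine (Complex.norm_exp_sub_one_sub_id_le (by rw [hn]; exact h)).trans ?_
    rw [hn, sq_abs]
    nlinarith [sq_nonneg t]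
  · have h1 : ‖Complex.exp (Complex.I * t) - 1‖ ≤ |t| := Real.norm_exp_I_mul_ofReal_sub_one_le
    refine (norm_sub_le _ _).trans ?_
    rw [hn]
    nlinarith [sq_abs t]

theorem norm_phaseLp_sub_le {p : ENNReal} {g : ℝ → ℂ} (h0 : MemLp g p volume)
    (h1 : MemLp (fun η : ℝ => (4 * Real.pi * Complex.I * η) * g η) p volume) (x y : ℝ) :
    ‖phaseLp h0 y - phaseLp h0 x‖ ≤ |y - x| * ‖h1.toLp _‖ := by
  refine Lp.norm_le_mul_norm_of_ae_le_mul ?_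
  filter_upwards [Lp.coeFn_sub (phaseLp h0 y) (phaseLp h0 x), phaseLp_ae h0 x, phaseLp_ae h0 y,
    h1.coeFn_toLp] with η e1 e2 e3 e4
  rw [e1, Pi.sub_apply, e2, e3, e4]
  have e : phase g y η - phase g x η
      = Complex.exp (Complex.I * ((4 * Real.pi * x * η : ℝ) : ℂ)) *
        (Complex.exp (Complex.I * ((4 * Real.pi * (y - x) * η : ℝ) : ℂ)) - 1) * g η := by
    have : Complex.exp (Complex.I * ((4 * Real.pi * y * η : ℝ) : ℂ))
        = Complex.exp (Complex.I * ((4 * Real.pi * x * η : ℝ) : ℂ)) *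
          Complex.exp (Complex.I * ((4 * Real.pi * (y - x) * η : ℝ) : ℂ)) := by
      rw [← Complex.exp_add]; congr 1; push_cast; ring
    rw [phase, phase, this]; ring
  rw [e, norm_mul, norm_mul, mul_comm Complex.I, Complex.norm_exp_ofReal_mul_I, one_mul, norm_mul,
    ← mul_assoc]
  gcongr
  refine Real.norm_exp_I_mul_ofReal_sub_one_le.trans (le_of_eq ?_)
  simp
  ring

/-- The second-order Taylor bound for the exponential holds pointwise in η with the weight η² on g.
This gives a quadratic remainder in every Lᵖ, including p = ∞, where dominated convergence is
unavailable. -/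
theorem hasDerivAt_phaseLp {p : ENNReal} [Fact (1 ≤ p)] {g : ℝ → ℂ} (h0 : MemLp g p volume)
    (h1 : MemLp (fun η : ℝ => (4 * Real.pi * Complex.I * η) * g η) p volume)
    (h2 : MemLp (fun η : ℝ => (4 * Real.pi * Complex.I * η) ^ 2 * g η) p volume) (x : ℝ) :
    HasDerivAt (phaseLp h0) (phaseLp h1 x) x := by
  rw [hasDerivAt_iff_isLittleO]
  have hO : (fun y => phaseLp h0 y - phaseLp h0 x - (y - x) • phaseLp h1 x)
      =O[nhds x] fun y => (y - x) ^ 2 := by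
    refine Asymptotics.IsBigO.of_bound (2 * ‖h2.toLp _‖) (.of_forall fun y => ?_)
    rw [mul_right_comm (2 : ℝ) _ ‖(y - x) ^ 2‖]
    refine Lp.norm_le_mul_norm_of_ae_le_mul ?_
    filter_upwards [Lp.coeFn_sub (phaseLp h0 y - phaseLp h0 x) ((y - x) • phaseLp h1 x),
      Lp.coeFn_sub (phaseLp h0 y) (phaseLp h0 x), Lp.coeFn_smul (y - x) (phaseLp h1 x),
      phaseLp_ae h0 x, phaseLp_ae h0 y, phaseLp_ae h1 x, h2.coeFn_toLp] with η e1 e2 e3 e4 e5 e6 e7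
    rw [e1, Pi.sub_apply, e2, Pi.sub_apply, e3, Pi.smul_apply, e4, e5, e6, e7]
    have e : phase g y η - phase g x η
          - (y - x) • phase (fun η : ℝ => (4 * Real.pi * Complex.I * η) * g η) x η
        = Complex.exp (Complex.I * ((4 * Real.pi * x * η : ℝ) : ℂ)) *
          (Complex.exp (Complex.I * ((4 * Real.pi * (y - x) * η : ℝ) : ℂ)) - 1
            - Complex.I * ((4 * Real.pi * (y - x) * η : ℝ) : ℂ)) * g η := by
      have : Complex.exp (Complex.I * ((4 * Real.pi * y * η : ℝ) : ℂ))
          = Complex.exp (Complex.I * ((4 * Real.pi * x * η : ℝ) : ℂ)) *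
            Complex.exp (Complex.I * ((4 * Real.pi * (y - x) * η : ℝ) : ℂ)) := by
        rw [← Complex.exp_add]; congr 1; push_cast; ring
      rw [phase, phase, phase, this, Complex.real_smul]; push_cast; ring
    rw [e, norm_mul, norm_mul, mul_comm Complex.I, Complex.norm_exp_ofReal_mul_I, one_mul,
      norm_mul, ← mul_assoc]
    gcongr
    rw [mul_comm _ Complex.I]
    refine (norm_exp_I_sub_one_sub_le _).trans (le_of_eq ?_)
    simp [mul_pow]
    ring
  refine hO.trans_isLittleO ?_
  have : (fun y : ℝ => (y - x) ^ 2) = (fun y => (y - x) * (y - x)) := by ext; ring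
  rw [this]
  have ht : Filter.Tendsto (fun y : ℝ => y - x) (nhds x) (nhds 0) := by
    have : Continuous fun y : ℝ => y - x := by fun_prop
    simpa using this.tendsto x
  simpa using ((Asymptotics.isLittleO_one_iff ℝ).2 ht).mul_isBigO
    (Asymptotics.isBigO_refl (fun y : ℝ => y - x) (nhds x))

/-- Each derivative costs one power of η. The extra power gives continuity of the last derivative,
through a Lipschitz bound. -/
theorem contDiff_phaseLp {p : ENNReal} [Fact (1 ≤ p)] (r : ℕ) {g : ℝ → ℂ} (h0 : MemLp g p volume)
    (h : ∀ i ≤ r + 1, MemLp (fun η : ℝ => (η : ℂ) ^ i * g η) p volume) :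
    ContDiff ℝ r (phaseLp h0) := by
  have hi : ∀ i ≤ r + 1,
      MemLp (fun η : ℝ => (4 * Real.pi * Complex.I * η) ^ i * g η) p volume := by
    intro i hi
    refine ((h i hi).const_mul ((4 * Real.pi * Complex.I) ^ i)).ae_eq (.of_forall fun η => ?_)
    simp only [mul_pow]
    ring
  induction r generalizing g with
  | zero =>
    rw [Nat.cast_zero, contDiff_zero]
    have h1 : MemLp (fun η : ℝ => (4 * Real.pi * Complex.I * η) * g η) p volume := by
      simpa using hi 1 le_rfl
    refine (LipschitzWith.of_dist_le_mul (K := ‖h1.toLp _‖₊) fun x y => ?_).continuous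
    rw [dist_eq_norm, Real.dist_eq, coe_nnnorm, mul_comm]
    exact norm_phaseLp_sub_le h0 h1 y x
  | succ r ih =>
    have h1 : MemLp (fun η : ℝ => (4 * Real.pi * Complex.I * η) * g η) p volume := by
      simpa using hi 1 (by omega)
    have hd := hasDerivAt_phaseLp h0 h1 (hi 2 (by omega))
    rw [Nat.cast_succ, contDiff_succ_iff_deriv]
    refine ⟨fun x => (hd x).differentiableAt, by simp, ?_⟩
    rw [show deriv (phaseLp h0) = phaseLp h1 from funext fun x => (hd x).deriv]
    have hc : ∀ i ≤ r + 1, MemLp (fun η : ℝ => (η : ℂ) ^ i *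
        ((4 * Real.pi * Complex.I * η) * g η)) p volume := by
      intro i hi
      refine ((h (i + 1) (by omega)).const_mul (4 * Real.pi * Complex.I)).ae_eq
        (.of_forall fun η => ?_)
      simp only [pow_succ]
      ring
    refine ih h1 hc fun i hi => ?_
    refine ((hc i hi).const_mul ((4 * Real.pi * Complex.I) ^ i)).ae_eq (.of_forall fun η => ?_)
    simp only [mul_pow]
    ring

/-! ### Weak derivatives and Sobolev spaces on half-lines -/

theorem continuous_setIntegral_test_smul (a : ℝ) {φ : ℝ → ℝ} (hφ : Continuous φ)
    (hc : HasCompactSupport φ) :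
    Continuous fun u : Lp ℂ 2 (volume.restrict (Set.Ioi a)) => ∫ t in Set.Ioi a, φ t • u t := by
  have hm : MemLp (fun t => (φ t : ℂ)) 2 (volume.restrict (Set.Ioi a)) :=
    (hφ.memLp_of_hasCompactSupport (p := 2) hc).ofReal
  have e : (fun u : Lp ℂ 2 (volume.restrict (Set.Ioi a)) => ∫ t in Set.Ioi a, φ t • u t)
      = fun u => ⟪hm.toLp _, u⟫ := by
    ext u
    rw [L2.inner_def]
    refine integral_congr_ae ?_
    filter_upwards [hm.coeFn_toLp] with t ht
    rw [ht]
    simp [mul_comm]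
  rw [e]
  fun_prop

/-- Each weak-derivative condition equates two continuous functionals. Closedness gives
completeness, hence an orthogonal projection onto the Sobolev space. -/
theorem isClosed_sobolevH (m : ℕ) (a : ℝ) :
    IsClosed (SobolevH m a :
      Set (PiLp 2 fun _ : Fin (m + 1) => Lp ℂ 2 (volume.restrict (Set.Ioi a)))) := by
  have e : (SobolevH m a :
      Set (PiLp 2 fun _ : Fin (m + 1) => Lp ℂ 2 (volume.restrict (Set.Ioi a))))
      = ⋂ (j : Fin m) (φ : ℝ → ℝ) (_ : ContDiff ℝ (⊤ : ℕ∞) φ) (_ : HasCompactSupport φ)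
          (_ : tsupport φ ⊆ Set.Ioi a),
        {w | ∫ t in Set.Ioi a, deriv φ t • w j.castSucc t
          = - ∫ t in Set.Ioi a, φ t • w j.succ t} := by
    ext w
    simp only [Set.mem_iInter]
    rfl
  rw [e]
  refine isClosed_iInter fun j => isClosed_iInter fun φ => isClosed_iInter fun hφ =>
    isClosed_iInter fun hc => isClosed_iInter fun _ => isClosed_eq ?_ ?_
  · exact (continuous_setIntegral_test_smul a (hφ.continuous_deriv (by simp)) hc.deriv).comp
      (PiLp.continuous_apply 2 _ _)
  · exact ((continuous_setIntegral_test_smul a hφ.continuous hc).comp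
      (PiLp.continuous_apply 2 _ _)).neg

theorem IsWeakDeriv.unique {a : ℝ} {u v v' : Lp ℂ 2 (volume.restrict (Set.Ioi a))}
    (h : IsWeakDeriv a u v) (h' : IsWeakDeriv a u v') : v = v' := by
  have h0 : IsWeakDeriv a 0 (v - v') := by
    have := h.add (h'.smul (-1))
    simpa [sub_eq_add_neg] using this
  have hz : ∀ᵐ t : ℝ, t ∈ Set.Ioi a → (v - v') t = 0 := by
    refine isOpen_Ioi.ae_eq_zero_of_integral_contDiff_smul_eq_zero
      (locallyIntegrableOn_of_locallyIntegrable_restrict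
        ((Lp.memLp (v - v')).locallyIntegrable (by norm_num))) fun φ hφ hc hs => ?_
    have := h0 φ hφ hc hs
    have e1 : ∫ t in Set.Ioi a, deriv φ t • (0 : Lp ℂ 2 (volume.restrict (Set.Ioi a))) t = 0 := by
      refine integral_eq_zero_of_ae ?_
      filter_upwards [Lp.coeFn_zero ℂ 2 (volume.restrict (Set.Ioi a))] with t ht
      rw [ht]
      simp
    rw [e1, zero_eq_neg] at this
    rw [← this]
    refine (setIntegral_eq_integral_of_forall_compl_eq_zero fun t ht => ?_).symm
    rw [image_eq_zero_of_notMem_tsupport (fun h => ht (hs h)), zero_smul]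
  rw [← sub_eq_zero, Lp.eq_zero_iff_ae_eq_zero]
  exact (ae_restrict_iff' measurableSet_Ioi).2 hz

/-- Since weak derivatives are unique, the zeroth entry of the tuple determines the others one after
another. Uniqueness in L² thus passes to Hⁿ. -/
theorem SobolevH.ext_of_fn_ae {m : ℕ} {a : ℝ} {u v : SobolevH m a}
    (h : ∀ᵐ t ∂(volume.restrict (Set.Ioi a)), SobolevH.fn u t = SobolevH.fn v t) : u = v := by
  refine Subtype.ext (PiLp.ext fun j => ?_)
  induction j using Fin.induction with
  | zero => exact Lp.ext h
  | succ j ih =>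
    have hu := u.2 j
    rw [ih] at hu
    exact hu.unique (v.2 j)

theorem SobolevH.memLp_fn {m : ℕ} {a : ℝ} (u : SobolevH m a) :
    MemLp (SobolevH.fn u) 2 (volume.restrict (Set.Ioi a)) := Lp.memLp _

theorem measurePreserving_sub_Ioi (x : ℝ) :
    MeasurePreserving (fun t : ℝ => t - x) (volume.restrict (Set.Ioi x))
      (volume.restrict (Set.Ioi 0)) := by
  have h := (measurePreserving_sub_right (volume : Measure ℝ) x).restrict_preimage
    (measurableSet_Ioi (a := (0 : ℝ)))
  simpa using h

theorem measurePreserving_add_Ioi (x : ℝ) :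
    MeasurePreserving (fun p : ℝ => x + p) (volume.restrict (Set.Ioi 0))
      (volume.restrict (Set.Ioi x)) := by
  have h := (measurePreserving_add_left (volume : Measure ℝ) x).restrict_preimage
    (measurableSet_Ioi (a := x))
  simpa using h

theorem setIntegral_Ioi_comp_add (x : ℝ) (f : ℝ → ℂ) :
    ∫ p in Set.Ioi 0, f (x + p) = ∫ s in Set.Ioi x, f s :=
  (measurePreserving_add_Ioi x).integral_comp (measurableEmbedding_addLeft x) f

theorem integrableOn_Ioi_comp_add_iff (x : ℝ) (f : ℝ → ℂ) :
    IntegrableOn (fun p => f (x + p)) (Set.Ioi 0) ↔ IntegrableOn f (Set.Ioi x) :=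
  (measurePreserving_add_Ioi x).integrable_comp_emb (measurableEmbedding_addLeft x)

theorem ae_Ioi_comp_add_iff (x : ℝ) (P : ℝ → Prop) :
    (∀ᵐ p ∂(volume.restrict (Set.Ioi (0 : ℝ))), P (x + p)) ↔
      ∀ᵐ y ∂(volume.restrict (Set.Ioi x)), P y := by
  rw [← (measurePreserving_add_Ioi x).map_eq, (measurableEmbedding_addLeft x).ae_map_iff]

/-- Translation of functions on `(0, ∞)` to functions on `(x, ∞)`. -/
noncomputable def translateLp (x : ℝ) :
    HalfL2 → Lp ℂ 2 (volume.restrict (Set.Ioi x)) :=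
  Lp.compMeasurePreserving (fun t : ℝ => t - x) (measurePreserving_sub_Ioi x)

theorem translateLp_add_ae (x : ℝ) (u : HalfL2) :
    ∀ᵐ p ∂(volume.restrict (Set.Ioi (0 : ℝ))), translateLp x u (x + p) = u p := by
  have h : ∀ᵐ y ∂(volume.restrict (Set.Ioi x)), translateLp x u y = u (y - x) :=
    Lp.coeFn_compMeasurePreserving u (measurePreserving_sub_Ioi x)
  rw [← ae_Ioi_comp_add_iff] at h
  simpa using h

theorem IsWeakDeriv.translateLp {u v : HalfL2} (h : IsWeakDeriv 0 u v) (x : ℝ) :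
    IsWeakDeriv x (translateLp x u) (translateLp x v) := by
  intro φ hφ hc hs
  have hs' : tsupport (fun p => φ (x + p)) ⊆ Set.Ioi 0 := by
    have := tsupport_comp_subset_preimage φ (f := fun p : ℝ => x + p) (by fun_prop)
    intro p hp
    have := hs (this hp)
    simpa using this
  have hd : ∀ p, deriv (fun p => φ (x + p)) p = deriv φ (x + p) := fun p =>
    deriv_comp_const_add φ x p
  have key := h (fun p => φ (x + p)) (by fun_prop) (hc.comp_homeomorph (Homeomorph.addLeft x)) hs'
  rw [← setIntegral_Ioi_comp_add x, ← setIntegral_Ioi_comp_add x]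
  convert! key using 1
  · refine integral_congr_ae ?_
    filter_upwards [translateLp_add_ae x u] with p hp
    rw [hp, hd]
  · congr 1
    refine integral_congr_ae ?_
    filter_upwards [translateLp_add_ae x v] with p hp
    rw [hp]

/-- Translation of a Sobolev function on `(0, ∞)` to one on `(x, ∞)`. -/
noncomputable def SobolevH.translate {m : ℕ} (x : ℝ) (u : SobolevH m 0) : SobolevH m x :=
  ⟨WithLp.toLp 2 fun j => translateLp x ((u : PiLp 2 fun _ : Fin (m + 1) => HalfL2) j),
    fun j => (u.2 j).translateLp x⟩

theorem SobolevH.fn_translate_ae {m : ℕ} (x : ℝ) (u : SobolevH m 0) :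
    ∀ᵐ p ∂(volume.restrict (Set.Ioi (0 : ℝ))),
      SobolevH.fn (SobolevH.translate x u) (x + p) = SobolevH.fn u p :=
  translateLp_add_ae x _

/-- A curve in a Sobolev space is `C^k` as soon as all its components are. -/
theorem exists_contDiff_sobolevH {m k : ℕ} {a : ℝ}
    (f : ℝ → Fin (m + 1) → Lp ℂ 2 (volume.restrict (Set.Ioi a)))
    (hf : ∀ j, ContDiff ℝ k fun x => f x j)
    (hw : ∀ x (j : Fin m), IsWeakDeriv a (f x j.castSucc) (f x j.succ)) :
    ∃ U : ℝ → SobolevH m a, ContDiff ℝ k U ∧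
      ∀ x, SobolevH.fn (U x) = f x 0 := by
  let V := PiLp 2 fun _ : Fin (m + 1) => Lp ℂ 2 (volume.restrict (Set.Ioi a))
  let w : ℝ → V := fun x => WithLp.toLp 2 (f x)
  have hwc : ContDiff ℝ k w := by
    rw [contDiff_piLp]
    exact hf
  have : CompleteSpace (SobolevH m a) := (isClosed_sobolevH m a).completeSpace_coe
  refine ⟨fun x => ⟨w x, hw x⟩, ?_, fun x => rfl⟩
  -- The curve already lies in the subspace, so the projection leaves it unchanged. Its smoothness
  -- as a curve in the subspace follows from that of a continuous linear map composed with `w`.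
  have e : (fun x => (⟨w x, hw x⟩ : SobolevH m a))
      = fun x => (SobolevH m a).orthogonalProjectionOnto (w x) := by
    ext1 x
    exact (Submodule.orthogonalProjectionOnto_mem_subspace_eq_self
      (⟨w x, hw x⟩ : SobolevH m a)).symm
  rw [e]
  exact ((SobolevH m a).orthogonalProjectionOnto.restrictScalars ℝ).contDiff.comp hwc

/-! ### Exponentials on the half-line -/

theorem memLp_exp_neg {ν : ℝ} (hν : 0 < ν) :
    MemLp (fun p : ℝ => (Real.exp (-ν * p) : ℂ)) 2 (volume.restrict (Set.Ioi 0)) := by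
  have h : MemLp (fun p : ℝ => Real.exp (-ν * p)) 2 (volume.restrict (Set.Ioi 0)) := by
    rw [memLp_two_iff_integrable_sq (by fun_prop)]
    refine (integrableOn_exp_mul_Ioi (a := -(2 * ν)) (by linarith) 0).congr (.of_forall fun p => ?_)
    simp only
    rw [← Real.exp_nat_mul]
    congr 1
    push_cast
    ring
  exact h.ofReal

/-- The exponential `p ↦ exp (-ν p)` as a square integrable function on the half-line. -/
noncomputable def expL2 {ν : ℝ} (hν : 0 < ν) : HalfL2 := (memLp_exp_neg hν).toLp _

theorem expL2_ae {ν : ℝ} (hν : 0 < ν) :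
    expL2 hν =ᵐ[volume.restrict (Set.Ioi 0)] fun p => (Real.exp (-ν * p) : ℂ) :=
  (memLp_exp_neg hν).coeFn_toLp

theorem isWeakDeriv_expL2 {ν : ℝ} (hν : 0 < ν) :
    IsWeakDeriv 0 (expL2 hν) ((-(ν : ℂ)) • expL2 hν) := by
  intro φ hφ hc hs
  have hE : ∀ t : ℝ, HasDerivAt (fun p : ℝ => (Real.exp (-ν * p) : ℂ))
      (-(ν : ℂ) * (Real.exp (-ν * t) : ℂ)) t := by
    intro t
    have h : HasDerivAt (fun p : ℝ => Real.exp (-ν * p)) (Real.exp (-ν * t) * (-ν * 1)) t :=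
      ((hasDerivAt_id t).const_mul (-ν)).exp
    convert! h.ofReal_comp using 1
    push_cast
    ring
  have hφd : ∀ t : ℝ, HasDerivAt (fun p : ℝ => (φ p : ℂ)) ((deriv φ t : ℝ) : ℂ) t := fun t =>
    ((hφ.differentiable (by simp) t).hasDerivAt).ofReal_comp
  have hd : Continuous (deriv φ) := hφ.continuous_deriv (by simp)
  have hEc : Continuous fun p : ℝ => (Real.exp (-ν * p) : ℂ) := by fun_prop
  have hφc : Continuous fun p : ℝ => (φ p : ℂ) := by
    have := hφ.continuous; fun_prop
  have hc1 : HasCompactSupport fun p : ℝ => (φ p : ℂ) := hc.comp_left (g := fun r : ℝ => (r : ℂ)) rfl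
  have hc2 : HasCompactSupport fun p : ℝ => ((deriv φ p : ℝ) : ℂ) :=
    hc.deriv.comp_left (g := fun r : ℝ => (r : ℂ)) rfl
  have ibp := integral_mul_deriv_eq_deriv_mul_of_integrable (u := fun p : ℝ => (Real.exp (-ν * p) : ℂ))
    (v := fun p : ℝ => (φ p : ℂ)) (fun t _ => hE t) (fun t _ => hφd t)
    ((hEc.mul (Complex.continuous_ofReal.comp hd)).integrable_of_hasCompactSupport hc2.mul_left)
    (((continuous_const.mul hEc).mul hφc).integrable_of_hasCompactSupport hc1.mul_left)
    ((hEc.mul hφc).integrable_of_hasCompactSupport hc1.mul_left)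
  have e1 : ∫ t in Set.Ioi 0, deriv φ t • expL2 hν t
      = ∫ t, (Real.exp (-ν * t) : ℂ) * ((deriv φ t : ℝ) : ℂ) := by
    refine Eq.trans ?_ (setIntegral_eq_integral_of_forall_compl_eq_zero (s := Set.Ioi 0)
      fun t ht => ?_)
    · refine integral_congr_ae ?_
      filter_upwards [expL2_ae hν] with t ht
      rw [ht, Complex.real_smul, mul_comm]
    · rw [image_eq_zero_of_notMem_tsupport
        (f := deriv φ) (fun h => ht (hs (tsupport_deriv_subset h)))]
      simp
  have e2 : ∫ t in Set.Ioi 0, φ t • ((-(ν : ℂ)) • expL2 hν) t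
      = ∫ t, -(ν : ℂ) * (Real.exp (-ν * t) : ℂ) * (φ t : ℂ) := by
    refine Eq.trans ?_ (setIntegral_eq_integral_of_forall_compl_eq_zero (s := Set.Ioi 0)
      fun t ht => ?_)
    · refine integral_congr_ae ?_
      filter_upwards [expL2_ae hν, Lp.coeFn_smul (-(ν : ℂ)) (expL2 hν)] with t ht ht'
      rw [ht', Pi.smul_apply, ht, Complex.real_smul, smul_eq_mul]
      ring
    · rw [image_eq_zero_of_notMem_tsupport (f := φ) (fun h => ht (hs h))]
      simp
  rw [e1, e2, ibp]

/-! ### Symbols with polynomial decay -/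

/-- A measurable symbol bounded by a multiple of `(1 + |η|)^(-(n + 2))`. -/
structure SymbolDecay (n : ℕ) (c : ℝ → ℂ) : Prop where
  meas : AEStronglyMeasurable c volume
  bound : ∃ C, ∀ᵐ η : ℝ, (1 + |η|) ^ (n + 2) * ‖c η‖ ≤ C

theorem norm_pow_mul_le {n i r : ℕ} (h : i + r ≤ n) (η : ℝ) (z : ℂ) :
    ‖(η : ℂ) ^ i * z‖ ≤ ((1 + |η|) ^ n * ‖z‖) * ((1 + |η|) ^ r)⁻¹ := by
  have h1 : (0 : ℝ) < 1 + |η| := by positivity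
  have hz : |η| ^ i ≤ (1 + |η|) ^ i := by gcongr; linarith
  rw [norm_mul, norm_pow, Complex.norm_real, Real.norm_eq_abs]
  calc |η| ^ i * ‖z‖ ≤ (1 + |η|) ^ i * ‖z‖ := by gcongr
    _ = ((1 + |η|) ^ (i + r) * ‖z‖) * ((1 + |η|) ^ r)⁻¹ := by rw [pow_add]; field_simp
    _ ≤ _ := by
      gcongr
      linarith [abs_nonneg η]

namespace SymbolDecay

variable {n : ℕ} {c : ℝ → ℂ}

theorem meas_pow (h : SymbolDecay n c) (i : ℕ) :
    AEStronglyMeasurable (fun η : ℝ => (η : ℂ) ^ i * c η) volume :=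
  (by fun_prop : Continuous fun η : ℝ => (η : ℂ) ^ i).aestronglyMeasurable.mul h.meas

/-- The n + 2 powers of decay form a budget: i of them absorb the weight and r remain. Membership in
L^∞ needs r = 0, in L² it needs r = 1, and in L¹ it needs r = 2. -/
theorem norm_pow_mul_ae_le (h : SymbolDecay n c) :
    ∃ C, 0 ≤ C ∧ ∀ i r : ℕ, i + r ≤ n + 2 →
      ∀ᵐ η : ℝ, ‖(η : ℂ) ^ i * c η‖ ≤ C * ((1 + |η|) ^ r)⁻¹ := by
  obtain ⟨C, hC⟩ := h.bound
  refine ⟨|C|, abs_nonneg C, fun i r hir => ?_⟩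
  filter_upwards [hC] with η hη
  refine (norm_pow_mul_le hir η (c η)).trans ?_
  gcongr
  exact hη.trans (le_abs_self C)

theorem memLp_top_pow (h : SymbolDecay n c) {i : ℕ} (hi : i ≤ n + 2) :
    MemLp (fun η : ℝ => (η : ℂ) ^ i * c η) ⊤ volume := by
  obtain ⟨C, hC0, hC⟩ := h.norm_pow_mul_ae_le
  refine memLp_top_of_bound (h.meas_pow i) C ?_
  filter_upwards [hC i (n + 2 - i) (by omega)] with η hη
  refine hη.trans (mul_le_of_le_one_right hC0 (inv_le_one_of_one_le₀ (one_le_pow₀ ?_)))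
  linarith [abs_nonneg η]

theorem memLp_two_pow (h : SymbolDecay n c) {i : ℕ} (hi : i ≤ n + 1) :
    MemLp (fun η : ℝ => (η : ℂ) ^ i * c η) 2 volume := by
  obtain ⟨C, hC0, hC⟩ := h.norm_pow_mul_ae_le
  have hb : MemLp (fun η : ℝ => C * (1 + |η|)⁻¹) 2 volume := by
    have hc : Continuous fun η : ℝ => (1 + |η|)⁻¹ :=
      (by fun_prop : Continuous fun η : ℝ => 1 + |η|).inv₀ fun η => by positivity
    refine MemLp.const_mul ?_ C
    rw [memLp_two_iff_integrable_sq hc.aestronglyMeasurable]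
    refine integrable_inv_one_add_sq.mono (hc.pow 2).aestronglyMeasurable (.of_forall fun η => ?_)
    rw [Real.norm_of_nonneg (by positivity), Real.norm_of_nonneg (by positivity), inv_pow]
    gcongr
    nlinarith [sq_abs η, abs_nonneg η]
  refine hb.mono (h.meas_pow i) ?_
  filter_upwards [hC i 1 (by omega)] with η hη
  rw [Real.norm_of_nonneg (by positivity)]
  simpa using hη

theorem integrable_pow (h : SymbolDecay n c) {i : ℕ} (hi : i ≤ n) :
    Integrable (fun η : ℝ => (η : ℂ) ^ i * c η) := by
  obtain ⟨C, hC0, hC⟩ := h.norm_pow_mul_ae_le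
  refine (integrable_inv_one_add_sq.const_mul C).mono' (h.meas_pow i) ?_
  filter_upwards [hC i 2 (by omega)] with η hη
  refine hη.trans ?_
  gcongr
  nlinarith [sq_abs η, abs_nonneg η]

end SymbolDecay

/-- The symbol of the `j`-th derivative of the kernel with symbol `c`. -/
noncomputable def derivSymbol (j : ℕ) (c : ℝ → ℂ) (η : ℝ) : ℂ :=
  (2 * Real.pi * Complex.I * η) ^ j * c η

theorem derivSymbol_zero (c : ℝ → ℂ) : derivSymbol 0 c = c := by
  ext; simp [derivSymbol]

theorem derivSymbol_succ (j : ℕ) (c : ℝ → ℂ) (η : ℝ) :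
    derivSymbol (j + 1) c η = 2 * Real.pi * Complex.I * η * derivSymbol j c η := by
  simp only [derivSymbol, pow_succ]; ring

theorem SymbolDecay.derivSymbol {n j : ℕ} {c : ℝ → ℂ} (h : SymbolDecay n c) (hj : j ≤ n) :
    SymbolDecay (n - j) (derivSymbol j c) := by
  refine ⟨?_, ?_⟩
  · exact (by fun_prop : Continuous fun η : ℝ =>
      (2 * Real.pi * Complex.I * η : ℂ) ^ j).aestronglyMeasurable.mul h.meas
  · obtain ⟨C, hC⟩ := h.bound
    refine ⟨(2 * Real.pi) ^ j * C, ?_⟩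
    filter_upwards [hC] with η hη
    have h1 : ‖Marchenko.derivSymbol j c η‖ = (2 * Real.pi) ^ j * (|η| ^ j * ‖c η‖) := by
      simp [Marchenko.derivSymbol, mul_pow, abs_of_pos Real.pi_pos]
      ring
    rw [h1, mul_left_comm]
    gcongr
    calc (1 + |η|) ^ (n - j + 2) * (|η| ^ j * ‖c η‖)
        ≤ (1 + |η|) ^ (n - j + 2) * ((1 + |η|) ^ j * ‖c η‖) := by gcongr; linarith
      _ = (1 + |η|) ^ (n + 2) * ‖c η‖ := by
        rw [← mul_assoc, ← pow_add]; congr 2; omega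
      _ ≤ C := hη

theorem SymbolDecay.memLp_top {n : ℕ} {c : ℝ → ℂ} (h : SymbolDecay n c) : MemLp c ⊤ volume := by
  simpa using h.memLp_top_pow (i := 0) (by omega)

theorem SymbolDecay.memLp_two {n : ℕ} {c : ℝ → ℂ} (h : SymbolDecay n c) : MemLp c 2 volume := by
  simpa using h.memLp_two_pow (i := 0) (by omega)

theorem SymbolDecay.integrable {n : ℕ} {c : ℝ → ℂ} (h : SymbolDecay n c) : Integrable c := by
  simpa using h.integrable_pow (i := 0) (by omega)

open Classical in
/-- The curve of modulated symbols, set to zero for symbols outside `Lᵖ`. -/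
noncomputable def symbolCurve (p : ENNReal) (c : ℝ → ℂ) (x : ℝ) : Lp ℂ p (volume : Measure ℝ) :=
  if h : MemLp c p volume then phaseLp h x else 0

theorem symbolCurve_eq {p : ENNReal} {c : ℝ → ℂ} (h : MemLp c p volume) :
    symbolCurve p c = phaseLp h := by
  ext1 x; rw [symbolCurve, dif_pos h]

theorem symbolCurve_ae {p : ENNReal} {c : ℝ → ℂ} (h : MemLp c p volume) (x : ℝ) :
    symbolCurve p c x =ᵐ[volume] phase c x := by
  rw [symbolCurve_eq h]; exact phaseLp_ae h x

theorem symbolCurve_succ_ae {p : ENNReal} {j : ℕ} {c : ℝ → ℂ}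
    (h : MemLp (derivSymbol j c) p volume) (h' : MemLp (derivSymbol (j + 1) c) p volume) (x : ℝ) :
    ∀ᵐ η : ℝ, symbolCurve p (derivSymbol (j + 1) c) x η
      = 2 * Real.pi * Complex.I * η * symbolCurve p (derivSymbol j c) x η := by
  filter_upwards [symbolCurve_ae h x, symbolCurve_ae h' x] with η h1 h2
  rw [h1, h2, phase, phase, derivSymbol_succ]
  ring

theorem contDiff_symbolCurve_top {n j k : ℕ} {c : ℝ → ℂ} (h : SymbolDecay n c) (hjk : j + k ≤ n) :
    ContDiff ℝ k (symbolCurve ⊤ (derivSymbol j c)) := by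
  have hd := h.derivSymbol (j := j) (by omega)
  rw [symbolCurve_eq hd.memLp_top]
  exact contDiff_phaseLp k _ fun i hi => hd.memLp_top_pow (by omega)

/-- Here the budget is used up exactly: after j derivatives the weights available in L² go up to n -
j + 1, and a C^k curve asks for k + 1 of them. In L^∞ one power is left over. -/
theorem contDiff_symbolCurve_two {n j k : ℕ} {c : ℝ → ℂ} (h : SymbolDecay n c) (hjk : j + k ≤ n) :
    ContDiff ℝ k (symbolCurve 2 (derivSymbol j c)) := by
  have hd := h.derivSymbol (j := j) (by omega)
  rw [symbolCurve_eq hd.memLp_two]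
  exact contDiff_phaseLp k _ fun i hi => hd.memLp_two_pow (by omega)

/-! ### Kernels made of a Fourier symbol and finitely many exponentials -/

theorem IsWeakDeriv.sum {ι : Type*} (s : Finset ι) {a : ℝ}
    {u v : ι → Lp ℂ 2 (volume.restrict (Set.Ioi a))}
    (h : ∀ i ∈ s, IsWeakDeriv a (u i) (v i)) :
    IsWeakDeriv a (∑ i ∈ s, u i) (∑ i ∈ s, v i) := by
  classical
  induction s using Finset.induction_on with
  | empty => simpa using IsWeakDeriv.zero a
  | insert i s hi ih =>
    rw [Finset.sum_insert hi, Finset.sum_insert hi]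
    exact (h i (Finset.mem_insert_self i s)).add
      (ih fun k hk => h k (Finset.mem_insert_of_mem hk))

section Kernel

variable {N : ℕ} {ν : Fin N → ℝ} (hν : ∀ k, 0 < ν k) (α : Fin N → ℝ)

/-- The coefficient of the `k`-th exponential in the `j`-th derivative of the kernel, translated
by `2 x`. -/
noncomputable def expCoeff (ν α : Fin N → ℝ) (γ : Fin N → ℂ) (j : ℕ) (x : ℝ) (k : Fin N) : ℂ :=
  ((α k * Real.exp (-ν k * (2 * x)) : ℝ) : ℂ) * ((-(ν k : ℂ)) ^ j * γ k)

theorem contDiff_expCoeff (γ : Fin N → ℂ) (j : ℕ) (k : Fin N) {r : ℕ∞} :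
    ContDiff ℝ r fun x => expCoeff ν α γ j x k := by
  have h : ContDiff ℝ r fun x : ℝ => ((α k * Real.exp (-ν k * (2 * x)) : ℝ) : ℂ) :=
    Complex.ofRealCLM.contDiff.comp
      (by fun_prop : ContDiff ℝ r fun x : ℝ => α k * Real.exp (-ν k * (2 * x)))
  exact h.mul contDiff_const

/-- The kernel `𝓕⁻ c + ∑ₖ αₖ γₖ exp (-νₖ ·)`. -/
noncomputable def kernel (ν α : Fin N → ℝ) (c : ℝ → ℂ) (γ : Fin N → ℂ) (z : ℝ) : ℂ :=
  𝓕⁻ c z + ∑ k, (α k : ℂ) * γ k * (Real.exp (-ν k * z) : ℂ)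

/-- The finite rank operator with kernel a sum of exponentials. -/
noncomputable def expOp (γ : Fin N → ℂ) (j : ℕ) (x : ℝ) : HalfL2 →L[ℂ] HalfL2 :=
  ∑ k, expCoeff ν α γ j x k • (innerSL ℂ (expL2 (hν k))).smulRight (expL2 (hν k))

/-- The Hankel operator with kernel the `j`-th derivative of `kernel`, translated by `2 x`. -/
noncomputable def kernelOp (c : ℝ → ℂ) (γ : Fin N → ℂ) (j : ℕ) (x : ℝ) : HalfL2 →L[ℂ] HalfL2 :=
  hankel (symbolCurve ⊤ (derivSymbol j c) x) + expOp hν α γ j x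

/-- The `j`-th derivative of `kernel`, translated by `2 x`, as a function on the half-line. -/
noncomputable def kernelRhs (c : ℝ → ℂ) (γ : Fin N → ℂ) (j : ℕ) (x : ℝ) : HalfL2 :=
  restrictHalf (𝓕⁻ (symbolCurve 2 (derivSymbol j c) x))
    + ∑ k, expCoeff ν α γ j x k • expL2 (hν k)

theorem expOp_apply (γ : Fin N → ℂ) (j : ℕ) (x : ℝ) (ψ : HalfL2) :
    expOp hν α γ j x ψ
      = ∑ k, expCoeff ν α γ j x k • (⟪expL2 (hν k), ψ⟫ • expL2 (hν k)) := by
  simp only [expOp, sum_apply, smul_apply,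
    ContinuousLinearMap.smulRight_apply, innerSL_apply_apply]

theorem contDiff_kernelOp {n j r : ℕ} {c : ℝ → ℂ} (h : SymbolDecay n c) (γ : Fin N → ℂ)
    (hjr : j + r ≤ n) : ContDiff ℝ r (kernelOp hν α c γ j) := by
  refine ContDiff.add ?_ ?_
  · exact (hankel.restrictScalars ℝ).contDiff.comp (contDiff_symbolCurve_top h hjr)
  · exact ContDiff.sum fun k _ =>
      (contDiff_expCoeff (ν := ν) α γ j k (r := r)).smul contDiff_const

theorem contDiff_kernelRhs {n j r : ℕ} {c : ℝ → ℂ} (h : SymbolDecay n c) (γ : Fin N → ℂ)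
    (hjr : j + r ≤ n) : ContDiff ℝ r (kernelRhs hν α c γ j) := by
  refine ContDiff.add ?_ ?_
  · exact ((restrictHalf ∘L fourierInvL2).restrictScalars ℝ).contDiff.comp
      (contDiff_symbolCurve_two h hjr)
  · exact ContDiff.sum fun k _ =>
      (contDiff_expCoeff (ν := ν) α γ j k (r := r)).smul contDiff_const

theorem isWeakDeriv_expCoeff_smul (γ : Fin N → ℂ) (j : ℕ) (x : ℝ) (k : Fin N) :
    IsWeakDeriv 0 (expCoeff ν α γ j x k • expL2 (hν k))
      (expCoeff ν α γ (j + 1) x k • expL2 (hν k)) := by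
  have h := (isWeakDeriv_expL2 (hν k)).smul (expCoeff ν α γ j x k)
  rw [smul_smul] at h
  convert! h using 2
  simp only [expCoeff, pow_succ]
  ring

/-- The derivative in p acts on the kernel only, so ψ need only be in L². -/
theorem isWeakDeriv_kernelOp {n j : ℕ} {c : ℝ → ℂ} (h : SymbolDecay n c) (γ : Fin N → ℂ)
    (hj : j + 1 ≤ n) (x : ℝ) (ψ : HalfL2) :
    IsWeakDeriv 0 (kernelOp hν α c γ j x ψ) (kernelOp hν α c γ (j + 1) x ψ) := by
  rw [kernelOp, kernelOp, add_apply, add_apply]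
  refine IsWeakDeriv.add ?_ ?_
  · exact isWeakDeriv_hankel (symbolCurve_succ_ae (h.derivSymbol (by omega)).memLp_top
      (h.derivSymbol hj).memLp_top x) ψ
  · rw [expOp_apply, expOp_apply]
    refine IsWeakDeriv.sum _ fun k _ => ?_
    rw [smul_comm, smul_comm (expCoeff ν α γ (j + 1) x k)]
    exact (isWeakDeriv_expCoeff_smul hν α γ j x k).smul _

theorem isWeakDeriv_kernelRhs {n j : ℕ} {c : ℝ → ℂ} (h : SymbolDecay n c) (γ : Fin N → ℂ)
    (hj : j + 1 ≤ n) (x : ℝ) :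
    IsWeakDeriv 0 (kernelRhs hν α c γ j x) (kernelRhs hν α c γ (j + 1) x) := by
  refine IsWeakDeriv.add ?_ ?_
  · exact isWeakDeriv_restrictHalf_fourierInv (symbolCurve_succ_ae
      (h.derivSymbol (by omega)).memLp_two (h.derivSymbol hj).memLp_two x)
  · exact IsWeakDeriv.sum _ fun k _ => isWeakDeriv_expCoeff_smul hν α γ j x k

theorem kernel_translate (c : ℝ → ℂ) (γ : Fin N → ℂ) (x z : ℝ) :
    kernel ν α c γ (2 * x + z)
      = 𝓕⁻ (phase c x) z + ∑ k, expCoeff ν α γ 0 x k * (Real.exp (-ν k * z) : ℂ) := by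
  rw [kernel, fourierInv_phase]
  congr 1
  refine Finset.sum_congr rfl fun k _ => ?_
  rw [mul_add, Real.exp_add, expCoeff]
  push_cast
  ring

theorem coeFn_sum_smul_expL2 (a : Fin N → ℂ) :
    ∀ᵐ p ∂(volume.restrict (Set.Ioi (0 : ℝ))),
      (∑ k, a k • expL2 (hν k) : HalfL2) p = ∑ k, a k * (Real.exp (-ν k * p) : ℂ) := by
  have h1 : ∀ᵐ p ∂(volume.restrict (Set.Ioi (0 : ℝ))), ∀ k,
      (a k • expL2 (hν k) : HalfL2) p = a k * (Real.exp (-ν k * p) : ℂ) := by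
    refine ae_all_iff.2 fun k => ?_
    filter_upwards [Lp.coeFn_smul (a k) (expL2 (hν k)), expL2_ae (hν k)] with p h1 h2
    rw [h1, Pi.smul_apply, h2, smul_eq_mul]
  filter_upwards [Lp.coeFn_finsetSum Finset.univ fun k => (a k • expL2 (hν k) : HalfL2), h1]
    with p h2 h3
  rw [h2, Finset.sum_apply]
  exact Finset.sum_congr rfl fun k _ => h3 k

theorem kernelRhs_ae {n : ℕ} {c : ℝ → ℂ} (h : SymbolDecay n c) (γ : Fin N → ℂ) (x : ℝ) :
    ∀ᵐ p ∂(volume.restrict (Set.Ioi (0 : ℝ))),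
      kernelRhs hν α c γ 0 x p = kernel ν α c γ (2 * x + p) := by
  have e : symbolCurve 2 (derivSymbol 0 c) x = (memLp_phase h.memLp_two x).toLp _ := by
    rw [derivSymbol_zero, symbolCurve_eq h.memLp_two]; rfl
  rw [kernelRhs, e]
  filter_upwards [Lp.coeFn_add
      (restrictHalf (𝓕⁻ ((memLp_phase h.memLp_two x).toLp (phase c x))))
      (∑ k, expCoeff ν α γ 0 x k • expL2 (hν k)),
    LpToLpRestrictCLM_coeFn ℂ (Set.Ioi (0 : ℝ))
      (𝓕⁻ ((memLp_phase h.memLp_two x).toLp (phase c x))),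
    ae_restrict_of_ae (fourierInv_toLp_ae (integrable_phase h.integrable x)
      (memLp_phase h.memLp_two x)),
    coeFn_sum_smul_expL2 hν (expCoeff ν α γ 0 x)] with p h1 h2 h3 h4
  rw [h1, Pi.add_apply, h2, h3, h4, kernel_translate]

theorem integrable_mul_fourierInv_add {n : ℕ} {c : ℝ → ℂ} (h : SymbolDecay n c) (ψ : HalfL2)
    (p : ℝ) : Integrable (fun q => ψ q * 𝓕⁻ c (p + q)) (volume.restrict (Set.Ioi 0)) := by
  have hm : MemLp (fun q => 𝓕⁻ c (p + q)) 2 volume :=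
    (memLp_fourierInv h.integrable h.memLp_two).comp_measurePreserving
      (measurePreserving_add_left volume p)
  exact (Lp.memLp ψ).integrable_mul (hm.restrict _)

theorem integrable_mul_exp_add {ν : ℝ} (hν : 0 < ν) (ψ : HalfL2) (a : ℂ) (p : ℝ) :
    Integrable (fun q => ψ q * (a * (Real.exp (-ν * (p + q)) : ℂ)))
      (volume.restrict (Set.Ioi 0)) := by
  refine (((Lp.memLp ψ).integrable_mul (memLp_exp_neg hν)).const_mul
    (a * (Real.exp (-ν * p) : ℂ))).congr (.of_forall fun q => ?_)
  simp only [Pi.mul_apply]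
  rw [mul_add, Real.exp_add]
  push_cast
  ring

theorem SymbolDecay.phase {n : ℕ} {c : ℝ → ℂ} (h : SymbolDecay n c) (x : ℝ) :
    SymbolDecay n (phase c x) := by
  refine ⟨aestronglyMeasurable_phase h.meas x, ?_⟩
  obtain ⟨C, hC⟩ := h.bound
  refine ⟨C, ?_⟩
  filter_upwards [hC] with η hη
  rwa [norm_phase]

theorem integrable_mul_kernel {n : ℕ} {c : ℝ → ℂ} (hν : ∀ k, 0 < ν k) (h : SymbolDecay n c)
    (γ : Fin N → ℂ) (ψ : HalfL2) (x p : ℝ) :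
    Integrable (fun q => ψ q * kernel ν α c γ (2 * x + (p + q)))
      (volume.restrict (Set.Ioi 0)) := by
  simp only [kernel_translate, mul_add, Finset.mul_sum]
  refine (integrable_mul_fourierInv_add (h.phase x) ψ p).add (integrable_finsetSum _ fun k _ => ?_)
  simpa only [mul_add] using integrable_mul_exp_add (hν k) ψ (expCoeff ν α γ 0 x k) p

theorem inner_expL2 {ν : ℝ} (hν : 0 < ν) (ψ : HalfL2) :
    ⟪expL2 hν, ψ⟫ = ∫ q in Set.Ioi 0, ψ q * (Real.exp (-ν * q) : ℂ) := by
  rw [L2.inner_def]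
  refine integral_congr_ae ?_
  filter_upwards [expL2_ae hν] with q hq
  rw [hq, RCLike.inner_apply, Complex.conj_ofReal]

/-- This is the link between the abstract operator and the integral in the Marchenko system: the
Fourier part is `hankel_apply_ae`, and exp(-νₖ(p + q)) factors into a rank one operator. -/
theorem kernelOp_apply_ae {n : ℕ} {c : ℝ → ℂ} (h : SymbolDecay n c) (γ : Fin N → ℂ) (x : ℝ)
    (ψ : HalfL2) :
    ∀ᵐ p ∂(volume.restrict (Set.Ioi (0 : ℝ))),
      kernelOp hν α c γ 0 x ψ p
        = ∫ q in Set.Ioi 0, ψ q * kernel ν α c γ (2 * x + (p + q)) := by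
  have e : symbolCurve ⊤ (derivSymbol 0 c) x = (h.phase x).memLp_top.toLp _ := by
    rw [derivSymbol_zero, symbolCurve_eq h.memLp_top]; rfl
  have e2 : expOp hν α γ 0 x ψ
      = ∑ k, (expCoeff ν α γ 0 x k * ⟪expL2 (hν k), ψ⟫) • expL2 (hν k) := by
    rw [expOp_apply]
    exact Finset.sum_congr rfl fun k _ => smul_smul _ _ _
  rw [kernelOp, add_apply, e, e2]
  filter_upwards [Lp.coeFn_add (hankel ((h.phase x).memLp_top.toLp (Marchenko.phase c x)) ψ)
      (∑ k, (expCoeff ν α γ 0 x k * ⟪expL2 (hν k), ψ⟫) • expL2 (hν k)),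
    hankel_apply_ae (h.phase x).integrable (h.phase x).memLp_two (h.phase x).memLp_top ψ,
    coeFn_sum_smul_expL2 hν (fun k => expCoeff ν α γ 0 x k * ⟪expL2 (hν k), ψ⟫)]
    with p h1 h2 h3
  rw [h1, Pi.add_apply, h2, h3]
  simp only [kernel_translate]
  simp only [mul_add (ψ _), Finset.mul_sum]
  rw [integral_add (integrable_mul_fourierInv_add (h.phase x) ψ p)
      (integrable_finsetSum _ fun k _ =>
        integrable_mul_exp_add (hν k) ψ (expCoeff ν α γ 0 x k) p),
    integral_finsetSum _ fun k _ => integrable_mul_exp_add (hν k) ψ (expCoeff ν α γ 0 x k) p]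
  congr 1
  refine Finset.sum_congr rfl fun k _ => ?_
  rw [inner_expL2, mul_right_comm, ← integral_const_mul]
  refine integral_congr_ae (.of_forall fun q => ?_)
  simp only
  rw [mul_add, Real.exp_add]
  push_cast
  ring

end Kernel

/-! ### The Marchenko system as an operator equation -/

/-- The parameter is real while the operators are complex linear, so the scalars are restricted
before the real calculus rule is applied. -/
theorem contDiff_clm_apply_complex {E F : Type*} [NormedAddCommGroup E] [NormedSpace ℂ E]
    [NormedAddCommGroup F] [NormedSpace ℂ F] {r : ℕ∞} {f : ℝ → E →L[ℂ] F} {g : ℝ → E}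
    (hf : ContDiff ℝ r f) (hg : ContDiff ℝ r g) : ContDiff ℝ r fun x => f x (g x) := by
  have h : ContDiff ℝ r fun x => ContinuousLinearMap.restrictScalarsL ℂ E F ℝ ℝ (f x) :=
    (ContinuousLinearMap.restrictScalarsL ℂ E F ℝ ℝ).contDiff.comp hf
  exact h.clm_apply hg

theorem contDiff_clm_comp_complex {E F G : Type*} [NormedAddCommGroup E] [NormedSpace ℂ E]
    [NormedAddCommGroup F] [NormedSpace ℂ F] [NormedAddCommGroup G] [NormedSpace ℂ G] {r : ℕ∞}
    {f : ℝ → E →L[ℂ] F} (hf : ContDiff ℝ r f) (A : G →L[ℂ] E) :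
    ContDiff ℝ r fun x => f x ∘L A :=
  (((ContinuousLinearMap.compL ℂ G E F).flip A).restrictScalars ℝ).contDiff.comp hf

theorem contDiff_comp_clm_complex {E F G : Type*} [NormedAddCommGroup E] [NormedSpace ℂ E]
    [NormedAddCommGroup F] [NormedSpace ℂ F] [NormedAddCommGroup G] [NormedSpace ℂ G] {r : ℕ∞}
    {f : ℝ → E →L[ℂ] F} (hf : ContDiff ℝ r f) (A : F →L[ℂ] G) :
    ContDiff ℝ r fun x => A ∘L f x :=
  (((ContinuousLinearMap.compL ℂ E F G) A).restrictScalars ℝ).contDiff.comp hf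

/-- Pairs of square integrable functions on the half-line with their Hilbert space structure. -/
abbrev PairL2 : Type := WithLp 2 (HalfL2 × HalfL2)

/-- The pair with the given components. -/
noncomputable abbrev mkPair : HalfL2 × HalfL2 →L[ℂ] PairL2 :=
  ((WithLp.prodContinuousLinearEquiv 2 ℂ HalfL2 HalfL2).symm :
    HalfL2 × HalfL2 →L[ℂ] PairL2)

/-- The row `(K, L)` of a block operator. -/
noncomputable def rowOp (K L : HalfL2 →L[ℂ] HalfL2) : PairL2 →L[ℂ] HalfL2 :=
  K ∘L WithLp.fstL 2 ℂ HalfL2 HalfL2 + L ∘L WithLp.sndL 2 ℂ HalfL2 HalfL2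

theorem rowOp_apply (K L : HalfL2 →L[ℂ] HalfL2) (Ψ : PairL2) :
    rowOp K L Ψ = K Ψ.fst + L Ψ.snd := rfl

theorem contDiff_rowOp {r : ℕ∞} {K L : ℝ → HalfL2 →L[ℂ] HalfL2} (hK : ContDiff ℝ r K)
    (hL : ContDiff ℝ r L) : ContDiff ℝ r fun x => rowOp (K x) (L x) :=
  (contDiff_clm_comp_complex hK _).add (contDiff_clm_comp_complex hL _)

/-- The operator `2√2 + (R₁, R₂)`. -/
noncomputable def systemOp (R₁ R₂ : PairL2 →L[ℂ] HalfL2) : PairL2 →L[ℂ] PairL2 :=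
  (2 * (√2 : ℂ)) • 1 + ((mkPair ∘L ContinuousLinearMap.inl ℂ HalfL2 HalfL2) ∘L R₁
    + (mkPair ∘L ContinuousLinearMap.inr ℂ HalfL2 HalfL2) ∘L R₂)

theorem systemOp_apply_fst (R₁ R₂ : PairL2 →L[ℂ] HalfL2) (Ψ : PairL2) :
    (systemOp R₁ R₂ Ψ).fst = (2 * (√2 : ℂ)) • Ψ.fst + R₁ Ψ := by
  change (2 * (√2 : ℂ)) • Ψ.fst + (R₁ Ψ + 0) = _
  rw [add_zero]

theorem systemOp_apply_snd (R₁ R₂ : PairL2 →L[ℂ] HalfL2) (Ψ : PairL2) :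
    (systemOp R₁ R₂ Ψ).snd = (2 * (√2 : ℂ)) • Ψ.snd + R₂ Ψ := by
  change (2 * (√2 : ℂ)) • Ψ.snd + (0 + R₂ Ψ) = _
  rw [zero_add]

theorem contDiff_systemOp {r : ℕ∞} {R₁ R₂ : ℝ → PairL2 →L[ℂ] HalfL2} (h₁ : ContDiff ℝ r R₁)
    (h₂ : ContDiff ℝ r R₂) : ContDiff ℝ r fun x => systemOp (R₁ x) (R₂ x) :=
  contDiff_const.add ((contDiff_comp_clm_complex h₁ _).add (contDiff_comp_clm_complex h₂ _))

/-- With a and b the inner products of the k-th exponential with u and v, the k-th summand is t|a +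
θₖ b|², where t = αₖ exp(-2νₖ x) ≥ 0. Unimodularity of θₖ lets |b|² be read as |θₖ b|² and so
completes the square. -/
theorem re_expOp_block_nonneg {N : ℕ} {ν : Fin N → ℝ} (hν : ∀ k, 0 < ν k) {α : Fin N → ℝ}
    (hα : ∀ k, 0 ≤ α k) {θ : Fin N → ℂ} (hθ : ∀ k, starRingEnd ℂ (θ k) * θ k = 1) (x : ℝ)
    (u v : HalfL2) :
    0 ≤ (⟪u, expOp hν α 1 0 x u + expOp hν α θ 0 x v⟫
      + ⟪v, expOp hν α (fun k => starRingEnd ℂ (θ k)) 0 x u + expOp hν α 1 0 x v⟫).re := by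
  simp only [expOp_apply, inner_add_right, inner_sum, inner_smul_right, ← Finset.sum_add_distrib,
    Complex.re_sum]
  refine Finset.sum_nonneg fun k _ => ?_
  set a := ⟪expL2 (hν k), u⟫ with ha
  set b := ⟪expL2 (hν k), v⟫ with hb
  have ha' : ⟪u, expL2 (hν k)⟫ = starRingEnd ℂ a := (inner_conj_symm _ _).symm
  have hb' : ⟪v, expL2 (hν k)⟫ = starRingEnd ℂ b := (inner_conj_symm _ _).symm
  rw [ha', hb']
  have h1 : expCoeff ν α 1 0 x k = ((α k * Real.exp (-ν k * (2 * x)) : ℝ) : ℂ) := by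
    simp [expCoeff]
  have h2 : ∀ γ : Fin N → ℂ, expCoeff ν α γ 0 x k
      = ((α k * Real.exp (-ν k * (2 * x)) : ℝ) : ℂ) * γ k := by
    simp [expCoeff]
  rw [h1, h2, h2]
  set t := α k * Real.exp (-ν k * (2 * x)) with ht
  have ht0 : 0 ≤ t := mul_nonneg (hα k) (Real.exp_pos _).le
  have e : (t : ℂ) * (a * starRingEnd ℂ a) + t * θ k * (b * starRingEnd ℂ a)
      + (t * starRingEnd ℂ (θ k) * (a * starRingEnd ℂ b) + t * (b * starRingEnd ℂ b))
      = ((t * Complex.normSq (a + θ k * b) : ℝ) : ℂ) := by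
    push_cast
    rw [← Complex.mul_conj, map_add, map_mul]
    linear_combination (-(t : ℂ) * b * starRingEnd ℂ b) * hθ k
  rw [e, Complex.ofReal_re]
  exact mul_nonneg ht0 (Complex.normSq_nonneg _)

/-- Modulation does not change the modulus; this is why one threshold serves every x. -/
theorem norm_symbolCurve_top_le {c : ℝ → ℂ} {δ : ℝ} (hδ : 0 ≤ δ) (hc : MemLp c ⊤ volume)
    (hb : ∀ᵐ η : ℝ, ‖c η‖ ≤ δ) (x : ℝ) : ‖symbolCurve ⊤ c x‖ ≤ δ := by
  have h : eLpNorm (symbolCurve ⊤ c x) ⊤ volume ≤ ENNReal.ofReal δ := by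
    rw [eLpNorm_exponent_top]
    refine eLpNormEssSup_le_of_ae_bound ?_
    filter_upwards [hb, symbolCurve_ae hc x] with η h1 h2
    rw [h2, norm_phase]
    exact h1
  rw [Lp.norm_def]
  exact ENNReal.toReal_le_of_le_ofReal hδ h

section System

variable {N : ℕ} {ν : Fin N → ℝ} (hν : ∀ k, 0 < ν k) (α : Fin N → ℝ) (θ : Fin N → ℂ)
  (c₀ cm cp : ℝ → ℂ)

/-- The `j`-th derivative of the first integral operator of the Marchenko system. -/
noncomputable def firstRow (j : ℕ) (x : ℝ) : PairL2 →L[ℂ] HalfL2 :=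
  rowOp (kernelOp hν α c₀ 1 j x) (kernelOp hν α cm θ j x)

/-- The `j`-th derivative of the second integral operator of the Marchenko system. -/
noncomputable def secondRow (j : ℕ) (x : ℝ) : PairL2 →L[ℂ] HalfL2 :=
  rowOp (kernelOp hν α cp (fun k => starRingEnd ℂ (θ k)) j x) (kernelOp hν α c₀ 1 j x)

/-- The operator of the Marchenko system. -/
noncomputable def marchenkoOp (x : ℝ) : PairL2 →L[ℂ] PairL2 :=
  systemOp (firstRow hν α θ c₀ cm 0 x) (secondRow hν α θ c₀ cp 0 x)

/-- The right-hand side of the Marchenko system. -/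
noncomputable def marchenkoRhs (x : ℝ) : PairL2 :=
  mkPair (kernelRhs hν α c₀ 1 0 x, kernelRhs hν α cp (fun k => starRingEnd ℂ (θ k)) 0 x)

/-- Coercivity: the scalar part contributes 2√2‖Ψ‖², the exponentials contribute a nonnegative
amount, and the four Hankel blocks take away at most (‖Ψ₁‖ + ‖Ψ₂‖)²/4 ≤ ‖Ψ‖²/2. What is left exceeds
‖Ψ‖². -/
theorem isUnit_marchenkoOp {n : ℕ} {α : Fin N → ℝ} {θ : Fin N → ℂ} {c₀ cm cp : ℝ → ℂ}
    (hα : ∀ k, 0 ≤ α k)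
    (hθ : ∀ k, starRingEnd ℂ (θ k) * θ k = 1) (h₀ : SymbolDecay n c₀) (hm : SymbolDecay n cm)
    (hp : SymbolDecay n cp) (b₀ : ∀ᵐ η : ℝ, ‖c₀ η‖ ≤ 1 / 4) (bm : ∀ᵐ η : ℝ, ‖cm η‖ ≤ 1 / 4)
    (bp : ∀ᵐ η : ℝ, ‖cp η‖ ≤ 1 / 4) (x : ℝ) :
    IsUnit (marchenkoOp hν α θ c₀ cm cp x) := by
  refine ContinuousLinearMap.isUnit_of_forall_le_norm_inner_map _ (c := 1) one_pos fun Ψ => ?_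
  rw [← norm_inner_symm, NNReal.coe_one, mul_one]
  refine le_trans ?_ (Complex.re_le_norm _)
  have hk : ∀ {c : ℝ → ℂ}, SymbolDecay n c → (∀ᵐ η : ℝ, ‖c η‖ ≤ 1 / 4) → ∀ u v : HalfL2,
      -(1 / 4 * (‖u‖ * ‖v‖)) ≤ (⟪u, hankel (symbolCurve ⊤ (derivSymbol 0 c) x) v⟫).re := by
    intro c hc hb u v
    rw [derivSymbol_zero]
    have h1 := norm_hankel_apply_le (symbolCurve ⊤ c x) v
    have h2 := norm_symbolCurve_top_le (by norm_num) hc.memLp_top hb x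
    have h3 := norm_inner_le_norm (𝕜 := ℂ) u (hankel (symbolCurve ⊤ c x) v)
    have h4 := (abs_le.1 (Complex.abs_re_le_norm ⟪u, hankel (symbolCurve ⊤ c x) v⟫)).1
    have h5 : ‖u‖ * ‖hankel (symbolCurve ⊤ c x) v‖ ≤ ‖u‖ * (1 / 4 * ‖v‖) := by
      refine mul_le_mul_of_nonneg_left (h1.trans ?_) (norm_nonneg u)
      exact mul_le_mul_of_nonneg_right h2 (norm_nonneg v)
    nlinarith
  have hE := re_expOp_block_nonneg hν hα hθ x Ψ.fst Ψ.snd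
  have hA := hk h₀ b₀ Ψ.fst Ψ.fst
  have hB := hk hm bm Ψ.fst Ψ.snd
  have hC := hk hp bp Ψ.snd Ψ.fst
  have hD := hk h₀ b₀ Ψ.snd Ψ.snd
  have hn : ‖Ψ‖ ^ 2 = ‖Ψ.fst‖ ^ 2 + ‖Ψ.snd‖ ^ 2 := WithLp.prod_norm_sq_eq_of_L2 Ψ
  have hs : ∀ u : HalfL2, (⟪u, (2 * (√2 : ℂ)) • u⟫).re = 2 * √2 * ‖u‖ ^ 2 := by
    intro u
    rw [inner_smul_right, inner_self_eq_norm_sq_to_K]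
    have : (2 * (√2 : ℂ)) * ((‖u‖ : ℝ) : ℂ) ^ 2 = ((2 * √2 * ‖u‖ ^ 2 : ℝ) : ℂ) := by push_cast; ring
    exact (congrArg Complex.re this).trans (Complex.ofReal_re _)
  have h2 : (1 : ℝ) ≤ √2 := Real.one_le_sqrt.2 (by norm_num)
  rw [WithLp.prod_inner_apply, marchenkoOp]
  change _ ≤ (⟪Ψ.fst, (systemOp _ _ Ψ).fst⟫ + ⟪Ψ.snd, (systemOp _ _ Ψ).snd⟫).re
  rw [systemOp_apply_fst, systemOp_apply_snd, firstRow, secondRow, rowOp_apply, rowOp_apply]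
  simp only [kernelOp, add_apply, inner_add_right, Complex.add_re, hs] at hE ⊢
  nlinarith [sq_nonneg (‖Ψ.fst‖ - ‖Ψ.snd‖), sq_nonneg ‖Ψ.fst‖, sq_nonneg ‖Ψ.snd‖]

/-- Solutions of the Marchenko operator equation have as many derivatives as the symbols decay,
with values in the corresponding Sobolev spaces. -/
theorem exists_sobolev_solution {n m k : ℕ} {α : Fin N → ℝ} {θ : Fin N → ℂ} {c₀ cm cp : ℝ → ℂ}
    (hu : ∀ x, IsUnit (marchenkoOp hν α θ c₀ cm cp x)) (h₀ : SymbolDecay n c₀)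
    (hm : SymbolDecay n cm) (hp : SymbolDecay n cp) (hmk : m + k ≤ n) :
    ∃ (Φ : ℝ → PairL2) (U : ℝ → SobolevH m 0 × SobolevH m 0), ContDiff ℝ k U ∧
      (∀ x, marchenkoOp hν α θ c₀ cm cp x (Φ x) = marchenkoRhs hν α θ c₀ cp x) ∧
      ∀ x, SobolevH.fn (U x).1 = (Φ x).fst ∧ SobolevH.fn (U x).2 = (Φ x).snd := by
  have hR₁ : ∀ j ≤ m, ContDiff ℝ k (firstRow hν α θ c₀ cm j) := fun j hj =>
    contDiff_rowOp (contDiff_kernelOp hν α h₀ _ (by omega)) (contDiff_kernelOp hν α hm _ (by omega))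
  have hR₂ : ∀ j ≤ m, ContDiff ℝ k (secondRow hν α θ c₀ cp j) := fun j hj =>
    contDiff_rowOp (contDiff_kernelOp hν α hp _ (by omega)) (contDiff_kernelOp hν α h₀ _ (by omega))
  have hA : ContDiff ℝ k (marchenkoOp hν α θ c₀ cm cp) :=
    contDiff_systemOp (hR₁ 0 (by omega)) (hR₂ 0 (by omega))
  have hb : ContDiff ℝ k (marchenkoRhs hν α θ c₀ cp) :=
    (mkPair.restrictScalars ℝ).contDiff.comp
      ((contDiff_kernelRhs hν α h₀ _ (by omega)).prodMk (contDiff_kernelRhs hν α hp _ (by omega)))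
  -- Inversion in the Banach algebra of bounded operators is smooth at units, and every operator of
  -- the family is a unit.
  have hinv : ContDiff ℝ k fun x => Ring.inverse (marchenkoOp hν α θ c₀ cm cp x) := by
    rw [contDiff_iff_contDiffAt]
    intro x
    obtain ⟨T, hT⟩ := hu x
    have h := contDiffAt_ringInverse ℝ (n := k) T
    rw [hT] at h
    exact h.comp x hA.contDiffAt
  let Φ : ℝ → PairL2 := fun x =>
    Ring.inverse (marchenkoOp hν α θ c₀ cm cp x) (marchenkoRhs hν α θ c₀ cp x)
  have hΦ : ContDiff ℝ k Φ := contDiff_clm_apply_complex hinv hb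
  have hsol : ∀ x, marchenkoOp hν α θ c₀ cm cp x (Φ x) = marchenkoRhs hν α θ c₀ cp x := by
    intro x
    have h := Ring.mul_inverse_cancel _ (hu x)
    exact DFunLike.congr_fun h (marchenkoRhs hν α θ c₀ cp x)
  let κ : ℂ := (2 * (√2 : ℂ))⁻¹
  have hκ : κ * (2 * (√2 : ℂ)) = 1 := by
    refine inv_mul_cancel₀ (mul_ne_zero two_ne_zero ?_)
    exact_mod_cast (Real.sqrt_pos.2 two_pos).ne'
  -- The equation is solved for the scalar term: entry j is (2√2)⁻¹ times the j-th kernel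
  -- derivatives applied to the same L² solution. Entry 0 gives back that solution, by the equation
  -- itself.
  obtain ⟨U₁, hU₁, hf₁⟩ := exists_contDiff_sobolevH (m := m) (k := k) (a := 0)
    (fun x j => κ • (kernelRhs hν α c₀ 1 j x + (-1 : ℂ) • firstRow hν α θ c₀ cm j x (Φ x)))
    (fun j => (((contDiff_kernelRhs hν α h₀ _ (by omega)).add
      ((contDiff_clm_apply_complex (hR₁ j (by omega)) hΦ).const_smul (-1 : ℂ)))).const_smul κ)
    (fun x j => ((isWeakDeriv_kernelRhs hν α h₀ _ (by have := j.2; simp only [Fin.val_castSucc]; omega) x).add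
      (((isWeakDeriv_kernelOp hν α h₀ _ (by have := j.2; simp only [Fin.val_castSucc]; omega) x _).add
        (isWeakDeriv_kernelOp hν α hm _ (by have := j.2; simp only [Fin.val_castSucc]; omega) x _)).smul _)).smul κ)
  obtain ⟨U₂, hU₂, hf₂⟩ := exists_contDiff_sobolevH (m := m) (k := k) (a := 0)
    (fun x j => κ • (kernelRhs hν α cp (fun k => starRingEnd ℂ (θ k)) j x
      + (-1 : ℂ) • secondRow hν α θ c₀ cp j x (Φ x)))
    (fun j => (((contDiff_kernelRhs hν α hp _ (by omega)).add
      ((contDiff_clm_apply_complex (hR₂ j (by omega)) hΦ).const_smul (-1 : ℂ)))).const_smul κ)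
    (fun x j => ((isWeakDeriv_kernelRhs hν α hp _ (by have := j.2; simp only [Fin.val_castSucc]; omega) x).add
      (((isWeakDeriv_kernelOp hν α hp _ (by have := j.2; simp only [Fin.val_castSucc]; omega) x _).add
        (isWeakDeriv_kernelOp hν α h₀ _ (by have := j.2; simp only [Fin.val_castSucc]; omega) x _)).smul _)).smul κ)
  refine ⟨Φ, fun x => (U₁ x, U₂ x), hU₁.prodMk hU₂, hsol, fun x => ⟨?_, ?_⟩⟩
  · rw [hf₁]
    have h := congrArg WithLp.fst (hsol x)
    rw [marchenkoOp, systemOp_apply_fst] at h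
    have h' : (2 * (√2 : ℂ)) • (Φ x).fst + firstRow hν α θ c₀ cm 0 x (Φ x)
      = kernelRhs hν α c₀ 1 0 x := h
    rw [Fin.val_zero, ← h', neg_one_smul, add_neg_cancel_right, smul_smul, hκ, one_smul]
  · rw [hf₂]
    have h := congrArg WithLp.snd (hsol x)
    rw [marchenkoOp, systemOp_apply_snd] at h
    have h' : (2 * (√2 : ℂ)) • (Φ x).snd + secondRow hν α θ c₀ cp 0 x (Φ x)
      = kernelRhs hν α cp (fun k => starRingEnd ℂ (θ k)) 0 x := h
    rw [Fin.val_zero, ← h', neg_one_smul, add_neg_cancel_right, smul_smul, hκ, one_smul]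

end System

/-! ### The scattering symbols -/

theorem lamOf_pos (ξ : ℝ) : 0 < lamOf ξ := Real.sqrt_pos.2 (by positivity)

theorem lamOf_sq (ξ : ℝ) : lamOf ξ ^ 2 = ξ ^ 2 + 1 / 2 := Real.sq_sqrt (by positivity)

theorem one_div_sqrt_two_sq : (1 / √2 : ℝ) ^ 2 = 1 / 2 := by
  rw [div_pow, Real.sq_sqrt (by norm_num)]; norm_num

theorem one_div_sqrt_two_le_lamOf (ξ : ℝ) : 1 / √2 ≤ lamOf ξ := by
  refine (sq_le_sq₀ (by positivity) (lamOf_pos ξ).le).1 ?_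
  rw [one_div_sqrt_two_sq, lamOf_sq]
  nlinarith [sq_nonneg ξ]

theorem abs_le_lamOf (ξ : ℝ) : |ξ| ≤ lamOf ξ := by
  refine (sq_le_sq₀ (by positivity) (lamOf_pos ξ).le).1 ?_
  rw [sq_abs, lamOf_sq]
  linarith

theorem continuous_lamOf : Continuous lamOf := by
  unfold lamOf; fun_prop

/-- Bounds on β hold only almost everywhere, so preimages of null sets must be null. Away from the
edge 1/√2, which corresponds to the single point ξ = 0, the preimage consists of images under ±√(t²
- 1/2), and differentiable maps send null sets to null sets. -/
theorem quasiMeasurePreserving_lamOf :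
    Measure.QuasiMeasurePreserving lamOf volume spectralMeasure := by
  refine ⟨continuous_lamOf.measurable, Measure.AbsolutelyContinuous.mk fun s hs h0 => ?_⟩
  rw [Measure.map_apply continuous_lamOf.measurable hs]
  rw [spectralMeasure, Measure.restrict_apply hs] at h0
  let Z : Set ℝ := s ∩ Set.Ioi (1 / √2)
  have hZ : volume Z = 0 := by
    refine measure_mono_null (fun l hl => ?_) h0
    exact ⟨hl.1, (le_of_lt hl.2).trans (le_abs_self l)⟩
  let g : ℝ → ℝ := fun t => √(t ^ 2 - 1 / 2)
  have hg : DifferentiableOn ℝ g Z := by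
    intro t ht
    have h1 : (1 / √2 : ℝ) < t := ht.2
    have h2 : (1 / √2 : ℝ) ^ 2 < t ^ 2 := by
      have : (0 : ℝ) ≤ 1 / √2 := by positivity
      gcongr
    rw [one_div_sqrt_two_sq] at h2
    have h3 : t ^ 2 - 1 / 2 ≠ 0 := by linarith
    exact ((by fun_prop : DifferentiableAt ℝ (fun t : ℝ => t ^ 2 - 1 / 2) t).sqrt
      h3).differentiableWithinAt
  have hI : volume (g '' Z) = 0 :=
    addHaar_image_eq_zero_of_differentiableOn_of_addHaar_eq_zero volume hg hZ
  have hN : volume (Neg.neg '' (g '' Z)) = 0 :=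
    addHaar_image_eq_zero_of_differentiableOn_of_addHaar_eq_zero volume
      (differentiable_neg.differentiableOn) hI
  have hsub : lamOf ⁻¹' s ⊆ ({0} ∪ g '' Z) ∪ Neg.neg '' (g '' Z) := by
    intro ξ hξ
    by_cases hξ0 : ξ = 0
    · exact Or.inl (Or.inl hξ0)
    have hgl : g (lamOf ξ) = |ξ| := by
      simp only [g]
      rw [lamOf_sq, add_sub_cancel_right, Real.sqrt_sq_eq_abs]
    have hmem : lamOf ξ ∈ Z := by
      refine ⟨hξ, ?_⟩
      refine lt_of_le_of_ne (one_div_sqrt_two_le_lamOf ξ) fun h => hξ0 ?_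
      have := lamOf_sq ξ
      rw [← h, one_div_sqrt_two_sq] at this
      exact pow_eq_zero_iff (two_ne_zero) |>.1 (by linarith)
    have habs : |ξ| ∈ g '' Z := ⟨_, hmem, hgl⟩
    rcases abs_choice ξ with h | h
    · rw [h] at habs
      exact Or.inl (Or.inr habs)
    · exact Or.inr ⟨|ξ|, habs, by rw [h, neg_neg]⟩
  refine measure_mono_null hsub ?_
  exact measure_union_null (measure_union_null (by simp) hI) hN

theorem quasiMeasurePreserving_lamOf_two_pi :
    Measure.QuasiMeasurePreserving (fun η : ℝ => lamOf (2 * Real.pi * η)) volume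
      spectralMeasure := by
  have h : Measure.QuasiMeasurePreserving (fun η : ℝ => 2 * Real.pi * η) volume volume := by
    refine ⟨by fun_prop, ?_⟩
    rw [Real.map_volume_mul_left (by positivity)]
    exact Measure.smul_absolutelyContinuous
  exact quasiMeasurePreserving_lamOf.comp h

theorem quasiMeasurePreserving_neg_lamOf_two_pi :
    Measure.QuasiMeasurePreserving (fun η : ℝ => -lamOf (2 * Real.pi * η)) volume
      spectralMeasure := by
  have h : MeasurePreserving (Neg.neg : ℝ → ℝ) spectralMeasure spectralMeasure := by
    have hs : MeasurableSet {l : ℝ | 1 / √2 ≤ |l|} :=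
      measurableSet_le measurable_const (by fun_prop)
    have := (Measure.measurePreserving_neg (volume : Measure ℝ)).restrict_preimage hs
    have e : (Neg.neg : ℝ → ℝ) ⁻¹' {l : ℝ | 1 / √2 ≤ |l|} = {l : ℝ | 1 / √2 ≤ |l|} := by
      ext l; simp
    rwa [e] at this
  exact h.quasiMeasurePreserving.comp quasiMeasurePreserving_lamOf_two_pi

theorem aestronglyMeasurable_of_pow_mul {β : ℝ → ℂ} {r : ℕ}
    (h : AEStronglyMeasurable (fun l : ℝ => (l : ℂ) ^ r * β l) spectralMeasure) :
    AEStronglyMeasurable β spectralMeasure := by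
  have hinv : Measurable fun l : ℝ => ((l : ℂ) ^ r)⁻¹ := by fun_prop
  refine (hinv.aestronglyMeasurable.mul h).congr ?_
  have hs : MeasurableSet {l : ℝ | 1 / √2 ≤ |l|} := measurableSet_le measurable_const (by fun_prop)
  filter_upwards [ae_restrict_mem hs] with l hl
  have hl0 : (l : ℂ) ≠ 0 := by
    rw [Complex.ofReal_ne_zero]
    rintro rfl
    have h1 : (0 : ℝ) < 1 / √2 := by positivity
    have h2 : 1 / √2 ≤ |(0 : ℝ)| := hl
    rw [abs_zero] at h2
    linarith
  simp only [Pi.mul_apply]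
  rw [← mul_assoc, inv_mul_cancel₀ (pow_ne_zero r hl0), one_mul]

theorem ae_norm_le_of_eLpNorm_top_le {f : ℝ → ℂ} {μ : Measure ℝ} {C : ℝ} (hC : 0 ≤ C)
    (h : eLpNorm f ⊤ μ ≤ ENNReal.ofReal C) : ∀ᵐ l ∂μ, ‖f l‖ ≤ C := by
  rw [eLpNorm_exponent_top] at h
  filter_upwards [ae_le_eLpNormEssSup (f := f) (μ := μ)] with l hl
  have := hl.trans h
  rwa [← ofReal_norm, ENNReal.ofReal_le_ofReal_iff hC] at this

theorem ae_pow_mul_norm_le {β : ℝ → ℂ} {r : ℕ} {C : ℝ} (hC : 0 ≤ C)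
    (h : eLpNorm (fun l : ℝ => (l : ℂ) ^ r * β l) ⊤ spectralMeasure ≤ ENNReal.ofReal C) :
    ∀ᵐ η : ℝ, lamOf (2 * Real.pi * η) ^ r * ‖β (lamOf (2 * Real.pi * η))‖ ≤ C ∧
      lamOf (2 * Real.pi * η) ^ r * ‖β (-lamOf (2 * Real.pi * η))‖ ≤ C := by
  have hb := ae_norm_le_of_eLpNorm_top_le hC h
  filter_upwards [quasiMeasurePreserving_lamOf_two_pi.ae hb,
    quasiMeasurePreserving_neg_lamOf_two_pi.ae hb] with η h1 h2
  simp only [norm_mul, norm_pow, Complex.norm_real, Real.norm_eq_abs, abs_neg,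
    abs_of_pos (lamOf_pos _)] at h1 h2
  exact ⟨h1, h2⟩

/-- The symbol of `F₁₂`. -/
noncomputable def symbol₁ (β : ℝ → ℂ) (η : ℝ) : ℂ := c₁ β (2 * Real.pi * η)

/-- The symbol of `F₂₂`. -/
noncomputable def symbol₂ (β : ℝ → ℂ) (η : ℝ) : ℂ := c₂ β (2 * Real.pi * η)

/-- The symbol of the derivative of `F₂₂`. -/
noncomputable def symbol₂Deriv (β : ℝ → ℂ) (η : ℝ) : ℂ :=
  2 * Real.pi * Complex.I * η * symbol₂ β η

/-- The symbol of `√2 (F₁₂ + σ F₂₂')`. -/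
noncomputable def symbolComb (σ : ℂ) (β : ℝ → ℂ) (η : ℝ) : ℂ :=
  √2 * (symbol₁ β η + σ * symbol₂Deriv β η)

/-! ### Pointwise bounds on the symbols in terms of β -/

section Bounds

variable {β : ℝ → ℂ} {r : ℕ} {C : ℝ}

/-- The factor |ξ| produced by differentiating is cancelled by the 1/λ in `c₂`, since |ξ| ≤ λ(ξ).
Hence the derivative of F₂₂ costs no decay and F₂' is on the same footing as F₁. -/
theorem ae_symbol_bounds (hC : 0 ≤ C)
    (h : eLpNorm (fun l : ℝ => (l : ℂ) ^ r * β l) ⊤ spectralMeasure ≤ ENNReal.ofReal C) :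
    ∀ᵐ η : ℝ, lamOf (2 * Real.pi * η) ^ r * ‖symbol₁ β η‖ ≤ 2 * C ∧
      lamOf (2 * Real.pi * η) ^ r * ‖symbol₂ β η‖ ≤ 3 * C ∧
      lamOf (2 * Real.pi * η) ^ r * ‖symbol₂Deriv β η‖ ≤ 2 * C := by
  filter_upwards [ae_pow_mul_norm_le hC h] with η hη
  set L := lamOf (2 * Real.pi * η) with hL
  have hL0 : 0 < L := lamOf_pos _
  have hLr : 0 < L ^ r := by positivity
  have hd : L ^ r * ‖β L - β (-L)‖ ≤ 2 * C := by
    have := mul_le_mul_of_nonneg_left (norm_sub_le (β L) (β (-L))) hLr.le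
    linarith [hη.1, hη.2]
  have h2 : ‖symbol₂ β η‖ = ‖β L - β (-L)‖ / L := by
    rw [symbol₂, c₂, norm_div, Complex.norm_real, Real.norm_of_nonneg hL0.le]
  refine ⟨?_, ?_, ?_⟩
  · have := mul_le_mul_of_nonneg_left (norm_add_le (β L) (β (-L))) hLr.le
    rw [symbol₁, c₁]
    linarith [hη.1, hη.2]
  -- The constant 3 is 2 · 3/2, with 1/λ ≤ √2 ≤ 3/2.
  · have h3 : 2 / 3 ≤ L := by
      refine le_trans ?_ (one_div_sqrt_two_le_lamOf _)
      rw [div_le_div_iff₀ (by norm_num) (by positivity)]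
      nlinarith [Real.sq_sqrt (show (0 : ℝ) ≤ 2 by norm_num), Real.sqrt_nonneg (2 : ℝ)]
    rw [h2, ← mul_div_assoc, div_le_iff₀ hL0]
    nlinarith
  · have h3 : |2 * Real.pi * η| ≤ L := abs_le_lamOf _
    have h4 : ‖symbol₂Deriv β η‖ = |2 * Real.pi * η| * (‖β L - β (-L)‖ / L) := by
      rw [symbol₂Deriv, norm_mul, h2]
      congr 1
      simp [abs_mul]
    rw [h4]
    refine le_trans (mul_le_mul_of_nonneg_left
      (mul_le_mul_of_nonneg_right h3 (by positivity)) hLr.le) ?_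
    rwa [mul_div_cancel₀ _ hL0.ne']

theorem ae_symbolComb_bound {σ : ℂ} (hσ : ‖σ‖ = 1) (hC : 0 ≤ C)
    (h : eLpNorm (fun l : ℝ => (l : ℂ) ^ r * β l) ⊤ spectralMeasure ≤ ENNReal.ofReal C) :
    ∀ᵐ η : ℝ, lamOf (2 * Real.pi * η) ^ r * ‖symbolComb σ β η‖ ≤ 6 * C := by
  filter_upwards [ae_symbol_bounds hC h] with η hη
  have hLr : 0 < lamOf (2 * Real.pi * η) ^ r := pow_pos (lamOf_pos _) r
  have h1 : ‖symbolComb σ β η‖ ≤ √2 * (‖symbol₁ β η‖ + ‖symbol₂Deriv β η‖) := by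
    rw [symbolComb, norm_mul, Complex.norm_real, Real.norm_of_nonneg (Real.sqrt_nonneg 2)]
    gcongr
    refine (norm_add_le _ _).trans ?_
    rw [norm_mul, hσ, one_mul]
  have h2 : √2 ≤ 3 / 2 := Real.sqrt_le_iff.2 ⟨by norm_num, by norm_num⟩
  calc _ ≤ lamOf (2 * Real.pi * η) ^ r * (√2 * (‖symbol₁ β η‖ + ‖symbol₂Deriv β η‖)) := by gcongr
    _ = √2 * (lamOf (2 * Real.pi * η) ^ r * ‖symbol₁ β η‖
        + lamOf (2 * Real.pi * η) ^ r * ‖symbol₂Deriv β η‖) := by ring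
    _ ≤ 3 / 2 * (2 * C + 2 * C) :=
      mul_le_mul h2 (add_le_add hη.1 hη.2.2) (by positivity) (by norm_num)
    _ = 6 * C := by ring

theorem ae_norm_le_of_lamOf_bound {c : ℝ → ℂ} {D : ℝ}
    (h : ∀ᵐ η : ℝ, lamOf (2 * Real.pi * η) ^ r * ‖c η‖ ≤ D) :
    ∀ᵐ η : ℝ, ‖c η‖ ≤ √2 ^ r * D := by
  filter_upwards [h] with η hη
  have h1 : (1 / √2 : ℝ) ^ r * ‖c η‖ ≤ D := by
    refine le_trans ?_ hη
    gcongr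
    exact one_div_sqrt_two_le_lamOf _
  have h2 : (0 : ℝ) < √2 ^ r := by positivity
  rw [one_div, inv_pow, inv_mul_le_iff₀ h2] at h1
  exact h1

theorem symbolDecay_of_lamOf_bound {n : ℕ} {c : ℝ → ℂ} {D : ℝ}
    (hm : AEStronglyMeasurable c volume)
    (h : ∀ᵐ η : ℝ, lamOf (2 * Real.pi * η) ^ (n + 2) * ‖c η‖ ≤ D) : SymbolDecay n c := by
  refine ⟨hm, 3 ^ (n + 2) * D, ?_⟩
  filter_upwards [h] with η hη
  -- The factor 3 is 2 + 1, from 1 ≤ 2λ and |η| ≤ λ at the frequency 2πη.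
  have h1 : 1 + |η| ≤ 3 * lamOf (2 * Real.pi * η) := by
    have h2 : |η| ≤ lamOf (2 * Real.pi * η) := by
      refine le_trans ?_ (abs_le_lamOf _)
      rw [abs_mul, abs_of_pos (by positivity : 0 < 2 * Real.pi)]
      nlinarith [abs_nonneg η, Real.pi_gt_three]
    have h3 : 1 / 2 ≤ lamOf (2 * Real.pi * η) := by
      refine le_trans ?_ (one_div_sqrt_two_le_lamOf _)
      have : √2 ≤ 2 := Real.sqrt_le_iff.2 ⟨by norm_num, by norm_num⟩
      gcongr
    linarith
  calc (1 + |η|) ^ (n + 2) * ‖c η‖ ≤ (3 * lamOf (2 * Real.pi * η)) ^ (n + 2) * ‖c η‖ := by gcongr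
    _ = 3 ^ (n + 2) * (lamOf (2 * Real.pi * η) ^ (n + 2) * ‖c η‖) := by rw [mul_pow]; ring
    _ ≤ 3 ^ (n + 2) * D := by gcongr

end Bounds

section Decay

variable {β : ℝ → ℂ} {n : ℕ}

theorem exists_eLpNorm_le_ofReal {f : ℝ → ℂ} {μ : Measure ℝ} (h : MemLp f ⊤ μ) :
    ∃ C, 0 ≤ C ∧ eLpNorm f ⊤ μ ≤ ENNReal.ofReal C :=
  ⟨(eLpNorm f ⊤ μ).toReal, ENNReal.toReal_nonneg, (ENNReal.ofReal_toReal h.2.ne).ge⟩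

theorem aestronglyMeasurable_symbols
    (hβ : MemLp (fun l : ℝ => (l : ℂ) ^ (n + 2) * β l) ⊤ spectralMeasure) :
    AEStronglyMeasurable (symbol₁ β) volume ∧ AEStronglyMeasurable (symbol₂ β) volume := by
  have hb := aestronglyMeasurable_of_pow_mul hβ.1
  have h1 := hb.comp_quasiMeasurePreserving quasiMeasurePreserving_lamOf_two_pi
  have h2 := hb.comp_quasiMeasurePreserving quasiMeasurePreserving_neg_lamOf_two_pi
  have h3 : Measurable fun η : ℝ => ((lamOf (2 * Real.pi * η) : ℝ) : ℂ) :=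
    Complex.measurable_ofReal.comp (continuous_lamOf.measurable.comp (by fun_prop))
  refine ⟨h1.add h2, ?_⟩
  have e : symbol₂ β = fun η => (β (lamOf (2 * Real.pi * η)) - β (-lamOf (2 * Real.pi * η)))
      * ((lamOf (2 * Real.pi * η) : ℝ) : ℂ)⁻¹ := by
    ext η; rw [symbol₂, c₂, div_eq_mul_inv]
  rw [e]
  exact (h1.sub h2).mul h3.inv.aestronglyMeasurable

theorem aestronglyMeasurable_symbol₂Deriv
    (hβ : MemLp (fun l : ℝ => (l : ℂ) ^ (n + 2) * β l) ⊤ spectralMeasure) :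
    AEStronglyMeasurable (symbol₂Deriv β) volume :=
  (by fun_prop : Continuous fun η : ℝ =>
    (2 * Real.pi * Complex.I * η : ℂ)).aestronglyMeasurable.mul (aestronglyMeasurable_symbols hβ).2

theorem symbolDecay_symbol₁
    (hβ : MemLp (fun l : ℝ => (l : ℂ) ^ (n + 2) * β l) ⊤ spectralMeasure) :
    SymbolDecay n (symbol₁ β) := by
  obtain ⟨C, hC0, hC⟩ := exists_eLpNorm_le_ofReal hβ
  exact symbolDecay_of_lamOf_bound (aestronglyMeasurable_symbols hβ).1
    ((ae_symbol_bounds hC0 hC).mono fun η h => h.1)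

theorem symbolDecay_symbol₂
    (hβ : MemLp (fun l : ℝ => (l : ℂ) ^ (n + 2) * β l) ⊤ spectralMeasure) :
    SymbolDecay n (symbol₂ β) := by
  obtain ⟨C, hC0, hC⟩ := exists_eLpNorm_le_ofReal hβ
  exact symbolDecay_of_lamOf_bound (aestronglyMeasurable_symbols hβ).2
    ((ae_symbol_bounds hC0 hC).mono fun η h => h.2.1)

theorem symbolDecay_symbol₂Deriv
    (hβ : MemLp (fun l : ℝ => (l : ℂ) ^ (n + 2) * β l) ⊤ spectralMeasure) :
    SymbolDecay n (symbol₂Deriv β) := by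
  obtain ⟨C, hC0, hC⟩ := exists_eLpNorm_le_ofReal hβ
  exact symbolDecay_of_lamOf_bound (aestronglyMeasurable_symbol₂Deriv hβ)
    ((ae_symbol_bounds hC0 hC).mono fun η h => h.2.2)

theorem symbolDecay_symbolComb {σ : ℂ} (hσ : ‖σ‖ = 1)
    (hβ : MemLp (fun l : ℝ => (l : ℂ) ^ (n + 2) * β l) ⊤ spectralMeasure) :
    SymbolDecay n (symbolComb σ β) := by
  obtain ⟨C, hC0, hC⟩ := exists_eLpNorm_le_ofReal hβ
  exact symbolDecay_of_lamOf_bound (((aestronglyMeasurable_symbols hβ).1.add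
    ((aestronglyMeasurable_symbol₂Deriv hβ).const_mul σ)).const_mul _)
    (ae_symbolComb_bound hσ hC0 hC)

end Decay

/-! ### The kernels of the Marchenko system -/

/-- The substitution ξ = 2πη passes between the two normalisations of the Fourier integral. -/
theorem fourierInv_comp_two_pi (c : ℝ → ℂ) (z : ℝ) :
    𝓕⁻ (fun η => c (2 * Real.pi * η)) z
      = 1 / (2 * (Real.pi : ℂ)) * ∫ ξ : ℝ, c ξ * Complex.exp (Complex.I * ξ * z) := by
  have h := Measure.integral_comp_mul_left
    (fun ξ : ℝ => c ξ * Complex.exp (Complex.I * ξ * z)) (2 * Real.pi)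
  rw [abs_of_pos (by positivity), Complex.real_smul] at h
  rw [Real.fourierInv_eq']
  have e : (1 / (2 * (Real.pi : ℂ))) = (((2 * Real.pi)⁻¹ : ℝ) : ℂ) := by push_cast; ring
  rw [e, ← h]
  refine integral_congr_ae (.of_forall fun η => ?_)
  simp only [smul_eq_mul]
  rw [mul_comm]
  congr 2
  simp
  ring

theorem F₁₂_eq (β : ℝ → ℂ) (z : ℝ) : F₁₂ β z = 𝓕⁻ (symbol₁ β) z :=
  (fourierInv_comp_two_pi (c₁ β) z).symm

theorem F₂₂_eq (β : ℝ → ℂ) (z : ℝ) : F₂₂ β z = 𝓕⁻ (symbol₂ β) z :=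
  (fourierInv_comp_two_pi (c₂ β) z).symm

theorem fourierInv_symbolComb {σ : ℂ} {β : ℝ → ℂ} (h₁ : Integrable (symbol₁ β))
    (h₂ : Integrable (symbol₂Deriv β)) (z : ℝ) :
    𝓕⁻ (symbolComb σ β) z = √2 * (𝓕⁻ (symbol₁ β) z + σ * 𝓕⁻ (symbol₂Deriv β) z) := by
  have hi : ∀ {f : ℝ → ℂ}, Integrable f → Integrable fun v : ℝ =>
      Complex.exp (((2 * Real.pi * inner ℝ v z : ℝ) : ℂ) * Complex.I) • f v := by
    intro f hf
    refine hf.mono ?_ (.of_forall fun v => ?_)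
    · exact (by fun_prop : Continuous fun v : ℝ =>
        Complex.exp (((2 * Real.pi * inner ℝ v z : ℝ) : ℂ) * Complex.I)).aestronglyMeasurable.smul
        hf.1
    · rw [norm_smul, Complex.norm_exp_ofReal_mul_I, one_mul]
  rw [Real.fourierInv_eq', Real.fourierInv_eq', Real.fourierInv_eq', ← integral_const_mul σ,
    ← integral_add (hi h₁) ((hi h₂).const_mul σ), ← integral_const_mul]
  refine integral_congr_ae (.of_forall fun v => ?_)
  simp only [symbolComb, smul_eq_mul]
  ring

section Kernels

variable {N n : ℕ} {lam mu : Fin N → ℝ} {β : ℝ → ℂ}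

theorem F₂_eq_kernel (z : ℝ) :
    F₂ lam mu β z = kernel (fun k => nuOf (lam k)) (fun k => -mu k) (symbol₂ β) 1 z := by
  rw [F₂, F₂₂_eq, F₂₁, kernel, sub_eq_add_neg, Complex.ofReal_sum, ← Finset.sum_neg_distrib]
  congr 1
  refine Finset.sum_congr rfl fun k _ => ?_
  push_cast
  simp

/-- The symbols of F₂₂ and of its derivative are both integrable, even for n = 0, so the `deriv` in
`Kplus` and `Kminus` is a true derivative. -/
theorem hasDerivAt_F₂
    (hβ : MemLp (fun l : ℝ => (l : ℂ) ^ (n + 2) * β l) ⊤ spectralMeasure) (z : ℝ) :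
    HasDerivAt (F₂ lam mu β) (𝓕⁻ (symbol₂Deriv β) z
      - ∑ k, (mu k : ℂ) * (-(nuOf (lam k) : ℂ)) * (Real.exp (-nuOf (lam k) * z) : ℂ)) z := by
  have h1 : HasDerivAt (F₂₂ β) (𝓕⁻ (symbol₂Deriv β) z) z := by
    rw [show F₂₂ β = 𝓕⁻ (symbol₂ β) from funext (F₂₂_eq β)]
    exact hasDerivAt_fourierInv (symbolDecay_symbol₂ hβ).integrable
      (symbolDecay_symbol₂Deriv hβ).integrable z
  have h2 : HasDerivAt (F₂₁ lam mu)
      ((∑ k, mu k * (Real.exp (-nuOf (lam k) * z) * (-nuOf (lam k) * 1)) : ℝ) : ℂ) z := by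
    refine HasDerivAt.ofReal_comp (f := fun z : ℝ => ∑ k, mu k * Real.exp (-nuOf (lam k) * z)) ?_
    refine HasDerivAt.fun_sum fun k _ => HasDerivAt.const_mul _ ?_
    exact ((hasDerivAt_id z).const_mul (-nuOf (lam k))).exp
  refine (h1.sub h2).congr_deriv ?_
  rw [Complex.ofReal_sum]
  congr 1
  refine Finset.sum_congr rfl fun k _ => ?_
  push_cast
  ring

/-- The unimodular numbers `√2 (λₖ + i νₖ)`. -/
noncomputable def eigenPhase (lam : Fin N → ℝ) (k : Fin N) : ℂ :=
  √2 * (lam k + Complex.I * nuOf (lam k))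

theorem one_half_sub_sq_pos {l : ℝ} (h : -(1 / √2) < l ∧ l < 1 / √2) : 0 < 1 / 2 - l ^ 2 := by
  have := sq_lt_sq' h.1 h.2
  rw [one_div_sqrt_two_sq] at this
  linarith

/-- This is λₖ² + νₖ² = 1/2, the relation that makes the exponential block positive. -/
theorem conj_eigenPhase_mul_self {k : Fin N} (h : -(1 / √2) < lam k ∧ lam k < 1 / √2) :
    starRingEnd ℂ (eigenPhase lam k) * eigenPhase lam k = 1 := by
  have h1 : nuOf (lam k) ^ 2 = 1 / 2 - lam k ^ 2 := Real.sq_sqrt (one_half_sub_sq_pos h).le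
  have h2 : (√2 : ℝ) ^ 2 = 2 := Real.sq_sqrt (by norm_num)
  have h1' : (nuOf (lam k) : ℂ) ^ 2 = 1 / 2 - (lam k : ℂ) ^ 2 := by
    have := congrArg Complex.ofReal h1
    push_cast at this
    exact this
  have h2' : ((√2 : ℝ) : ℂ) ^ 2 = 2 := by exact_mod_cast congrArg Complex.ofReal h2
  simp only [eigenPhase, map_mul, map_add, Complex.conj_ofReal, Complex.conj_I]
  linear_combination (((lam k : ℂ)) ^ 2 + (nuOf (lam k) : ℂ) ^ 2) * h2' + 2 * h1'
    - ((√2 : ℝ) : ℂ) ^ 2 * (nuOf (lam k) : ℂ) ^ 2 * Complex.I_sq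

/-- Differentiating exp(-νₖ z) brings out -νₖ, so F₁ + iF₂' carries λₖ - iνₖ and F₁ - iF₂' carries
its conjugate. The off-diagonal exponential blocks are therefore adjoint to each other. -/
theorem sqrt_two_mul_Kplus
    (hβ : MemLp (fun l : ℝ => (l : ℂ) ^ (n + 2) * β l) ⊤ spectralMeasure) (z : ℝ) :
    (√2 : ℂ) * Kplus lam mu β z
      = kernel (fun k => nuOf (lam k)) (fun k => -mu k) (symbolComb Complex.I β)
        (fun k => starRingEnd ℂ (eigenPhase lam k)) z := by
  rw [Kplus, (hasDerivAt_F₂ hβ z).deriv, kernel, F₁, F₁₂_eq, fourierInv_symbolComb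
    (symbolDecay_symbol₁ hβ).integrable (symbolDecay_symbol₂Deriv hβ).integrable, F₁₁]
  have e : ∀ k, ((-mu k : ℝ) : ℂ) * starRingEnd ℂ (eigenPhase lam k)
        * (Real.exp (-nuOf (lam k) * z) : ℂ)
      = √2 * (-((mu k * lam k * Real.exp (-nuOf (lam k) * z) : ℝ) : ℂ) - Complex.I *
        ((mu k : ℂ) * (-(nuOf (lam k) : ℂ)) * (Real.exp (-nuOf (lam k) * z) : ℂ))) := by
    intro k
    simp only [eigenPhase, map_mul, map_add, Complex.conj_ofReal, Complex.conj_I]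
    push_cast
    ring
  simp only [e]
  rw [← Finset.mul_sum, Finset.sum_sub_distrib, Finset.sum_neg_distrib, ← Finset.mul_sum,
    Complex.ofReal_sum]
  ring

theorem sqrt_two_mul_Kminus
    (hβ : MemLp (fun l : ℝ => (l : ℂ) ^ (n + 2) * β l) ⊤ spectralMeasure) (z : ℝ) :
    (√2 : ℂ) * Kminus lam mu β z
      = kernel (fun k => nuOf (lam k)) (fun k => -mu k) (symbolComb (-Complex.I) β)
        (eigenPhase lam) z := by
  rw [Kminus, (hasDerivAt_F₂ hβ z).deriv, kernel, F₁, F₁₂_eq, fourierInv_symbolComb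
    (symbolDecay_symbol₁ hβ).integrable (symbolDecay_symbol₂Deriv hβ).integrable, F₁₁]
  have e : ∀ k, ((-mu k : ℝ) : ℂ) * eigenPhase lam k * (Real.exp (-nuOf (lam k) * z) : ℂ)
      = √2 * (-((mu k * lam k * Real.exp (-nuOf (lam k) * z) : ℝ) : ℂ) + Complex.I *
        ((mu k : ℂ) * (-(nuOf (lam k) : ℂ)) * (Real.exp (-nuOf (lam k) * z) : ℂ))) := by
    intro k
    simp only [eigenPhase]
    push_cast
    ring
  simp only [e]
  rw [← Finset.mul_sum, Finset.sum_add_distrib, Finset.sum_neg_distrib, ← Finset.mul_sum,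
    Complex.ofReal_sum]
  ring

end Kernels

/-! ### Marchenko solutions as solutions of the operator equation -/

section Equivalence

variable {N n : ℕ}

theorem row_equation_iff {ν : Fin N → ℝ} (hν : ∀ k, 0 < ν k) (α : Fin N → ℝ)
    {c d e : ℝ → ℂ} (hc : SymbolDecay n c) (hd : SymbolDecay n d) (he : SymbolDecay n e)
    (γ δ ε : Fin N → ℂ) (x : ℝ) (u ψ₁ ψ₂ : HalfL2) :
    (2 * (√2 : ℂ)) • u + (kernelOp hν α c γ 0 x ψ₁ + kernelOp hν α d δ 0 x ψ₂)
        = kernelRhs hν α e ε 0 x ↔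
      ∀ᵐ p ∂(volume.restrict (Set.Ioi (0 : ℝ))),
        2 * (√2 : ℂ) * u p = kernel ν α e ε (2 * x + p)
          - ∫ q in Set.Ioi 0, (ψ₁ q * kernel ν α c γ (2 * x + (p + q))
            + ψ₂ q * kernel ν α d δ (2 * x + (p + q))) := by
  have h : ∀ᵐ p ∂(volume.restrict (Set.Ioi (0 : ℝ))),
      ((2 * (√2 : ℂ)) • u + (kernelOp hν α c γ 0 x ψ₁ + kernelOp hν α d δ 0 x ψ₂) : HalfL2) p
        = 2 * (√2 : ℂ) * u p
          + ∫ q in Set.Ioi 0, (ψ₁ q * kernel ν α c γ (2 * x + (p + q))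
            + ψ₂ q * kernel ν α d δ (2 * x + (p + q))) := by
    filter_upwards [Lp.coeFn_add ((2 * (√2 : ℂ)) • u)
        (kernelOp hν α c γ 0 x ψ₁ + kernelOp hν α d δ 0 x ψ₂), Lp.coeFn_smul (2 * (√2 : ℂ)) u,
      Lp.coeFn_add (kernelOp hν α c γ 0 x ψ₁) (kernelOp hν α d δ 0 x ψ₂),
      kernelOp_apply_ae hν α hc γ x ψ₁, kernelOp_apply_ae hν α hd δ x ψ₂] with p h1 h2 h3 h4 h5
    rw [h1, Pi.add_apply, h2, Pi.smul_apply, h3, Pi.add_apply, h4, h5, smul_eq_mul,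
      integral_add (integrable_mul_kernel α hν hc γ ψ₁ x p)
        (integrable_mul_kernel α hν hd δ ψ₂ x p)]
  have hR := kernelRhs_ae hν α he ε x
  constructor
  · intro heq
    rw [heq] at h
    filter_upwards [h, hR] with p h1 h2
    rw [← h2, h1, add_sub_cancel_right]
  · intro heq
    refine Lp.ext ?_
    filter_upwards [h, hR, heq] with p h1 h2 h3
    rw [h1, h2, h3, sub_add_cancel]

/-- Under y = x + p and s = x + q the argument s + y becomes 2x + p + q, and the factors √2 of the
system are absorbed into the off-diagonal kernels. -/
theorem isMarchenkoSolution_iff {lam mu : Fin N → ℝ} (hν : ∀ k, 0 < nuOf (lam k)) {β : ℝ → ℂ}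
    (hβ : MemLp (fun l : ℝ => (l : ℂ) ^ (n + 2) * β l) ⊤ spectralMeasure) {x : ℝ}
    {Ψ₁ Ψ₂ : ℝ → ℂ} {ψ : PairL2}
    (h₁ : ∀ᵐ p ∂(volume.restrict (Set.Ioi (0 : ℝ))), Ψ₁ (x + p) = ψ.fst p)
    (h₂ : ∀ᵐ p ∂(volume.restrict (Set.Ioi (0 : ℝ))), Ψ₂ (x + p) = ψ.snd p) :
    IsMarchenkoSolution lam mu β x Ψ₁ Ψ₂ ↔
      marchenkoOp hν (fun k => -mu k) (eigenPhase lam) (symbol₂ β) (symbolComb (-Complex.I) β)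
          (symbolComb Complex.I β) x ψ
        = marchenkoRhs hν (fun k => -mu k) (eigenPhase lam) (symbol₂ β)
          (symbolComb Complex.I β) x := by
  have d₀ := symbolDecay_symbol₂ hβ
  have dm := symbolDecay_symbolComb (σ := -Complex.I) (by simp) hβ
  have dp := symbolDecay_symbolComb (σ := Complex.I) (by simp) hβ
  set ν : Fin N → ℝ := fun k => nuOf (lam k) with hνdef
  set α : Fin N → ℝ := fun k => -mu k with hα
  set θ := eigenPhase lam with hθ
  have hsys : marchenkoOp hν α θ (symbol₂ β) (symbolComb (-Complex.I) β)
          (symbolComb Complex.I β) x ψ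
        = marchenkoRhs hν α θ (symbol₂ β) (symbolComb Complex.I β) x ↔
      (2 * (√2 : ℂ)) • ψ.fst + (kernelOp hν α (symbol₂ β) 1 0 x ψ.fst
          + kernelOp hν α (symbolComb (-Complex.I) β) θ 0 x ψ.snd)
          = kernelRhs hν α (symbol₂ β) 1 0 x ∧
      (2 * (√2 : ℂ)) • ψ.snd + (kernelOp hν α (symbolComb Complex.I β)
          (fun k => starRingEnd ℂ (θ k)) 0 x ψ.fst + kernelOp hν α (symbol₂ β) 1 0 x ψ.snd)
          = kernelRhs hν α (symbolComb Complex.I β) (fun k => starRingEnd ℂ (θ k)) 0 x := by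
    rw [← rowOp_apply, ← rowOp_apply]
    constructor
    · intro h
      refine ⟨?_, ?_⟩
      · have := congrArg WithLp.fst h
        rwa [marchenkoOp, systemOp_apply_fst] at this
      · have := congrArg WithLp.snd h
        rwa [marchenkoOp, systemOp_apply_snd] at this
    · rintro ⟨ha, hb⟩
      refine (WithLp.prodContinuousLinearEquiv 2 ℂ HalfL2 HalfL2).injective (Prod.ext ?_ ?_)
      · exact (systemOp_apply_fst _ _ ψ).trans ha
      · exact (systemOp_apply_snd _ _ ψ).trans hb
  have hK₁ : ∀ p : ℝ, (fun q => (√2 : ℂ) * Ψ₂ (x + q) * Kminus lam mu β (x + q + (x + p))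
        + Ψ₁ (x + q) * F₂ lam mu β (x + q + (x + p))) =ᵐ[volume.restrict (Set.Ioi 0)]
      fun q => ψ.fst q * kernel ν α (symbol₂ β) 1 (2 * x + (p + q))
        + ψ.snd q * kernel ν α (symbolComb (-Complex.I) β) θ (2 * x + (p + q)) := by
    intro p
    filter_upwards [h₁, h₂] with q e1 e2
    rw [← sqrt_two_mul_Kminus hβ, ← F₂_eq_kernel, e1, e2,
      show x + q + (x + p) = 2 * x + (p + q) by ring]
    ring
  have hK₂ : ∀ p : ℝ, (fun q => (√2 : ℂ) * Ψ₁ (x + q) * Kplus lam mu β (x + q + (x + p))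
        + Ψ₂ (x + q) * F₂ lam mu β (x + q + (x + p))) =ᵐ[volume.restrict (Set.Ioi 0)]
      fun q => ψ.fst q * kernel ν α (symbolComb Complex.I β)
          (fun k => starRingEnd ℂ (θ k)) (2 * x + (p + q))
        + ψ.snd q * kernel ν α (symbol₂ β) 1 (2 * x + (p + q)) := by
    intro p
    filter_upwards [h₁, h₂] with q e1 e2
    rw [← sqrt_two_mul_Kplus hβ, ← F₂_eq_kernel, e1, e2,
      show x + q + (x + p) = 2 * x + (p + q) by ring]
    ring
  rw [hsys, row_equation_iff hν α d₀ dm d₀, row_equation_iff hν α dp d₀ dp,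
    ← Filter.eventually_and, IsMarchenkoSolution, ← ae_Ioi_comp_add_iff]
  refine Filter.eventually_congr ?_
  filter_upwards [h₁, h₂] with p e1 e2
  -- Absolute convergence is automatic: it pairs an L² function with a kernel that is L² on the
  -- half-line.
  have i₁ : IntegrableOn (fun s => (√2 : ℂ) * Ψ₂ s * Kminus lam mu β (s + (x + p))
      + Ψ₁ s * F₂ lam mu β (s + (x + p))) (Set.Ioi x) :=
    (integrableOn_Ioi_comp_add_iff x _).1 (((integrable_mul_kernel α hν d₀ 1 ψ.fst x p).add
      (integrable_mul_kernel α hν dm θ ψ.snd x p)).congr (hK₁ p).symm)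
  have i₂ : IntegrableOn (fun s => (√2 : ℂ) * Ψ₁ s * Kplus lam mu β (s + (x + p))
      + Ψ₂ s * F₂ lam mu β (s + (x + p))) (Set.Ioi x) :=
    (integrableOn_Ioi_comp_add_iff x _).1 (((integrable_mul_kernel α hν dp _ ψ.fst x p).add
      (integrable_mul_kernel α hν d₀ 1 ψ.snd x p)).congr (hK₂ p).symm)
  rw [← setIntegral_Ioi_comp_add x, ← setIntegral_Ioi_comp_add x, integral_congr_ae (hK₁ p),
    integral_congr_ae (hK₂ p), e1, e2, sqrt_two_mul_Kplus hβ, F₂_eq_kernel,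
    show x + (x + p) = 2 * x + p by ring]
  exact ⟨fun h => h.2.2, fun h => ⟨i₁, i₂, h⟩⟩

theorem ae_eq_of_isMarchenkoSolution {lam mu : Fin N → ℝ} (hν : ∀ k, 0 < nuOf (lam k))
    {β : ℝ → ℂ} (hβ : MemLp (fun l : ℝ => (l : ℂ) ^ (n + 2) * β l) ⊤ spectralMeasure) {x : ℝ}
    (hu : IsUnit (marchenkoOp hν (fun k => -mu k) (eigenPhase lam) (symbol₂ β)
      (symbolComb (-Complex.I) β) (symbolComb Complex.I β) x))
    {Φ : PairL2}
    (hΦ : marchenkoOp hν (fun k => -mu k) (eigenPhase lam) (symbol₂ β) (symbolComb (-Complex.I) β)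
          (symbolComb Complex.I β) x Φ
        = marchenkoRhs hν (fun k => -mu k) (eigenPhase lam) (symbol₂ β)
          (symbolComb Complex.I β) x)
    {m : ℕ} {Ψ : SobolevH m x × SobolevH m x}
    (hΨ : IsMarchenkoSolution lam mu β x (SobolevH.fn Ψ.1) (SobolevH.fn Ψ.2)) :
    (∀ᵐ p ∂(volume.restrict (Set.Ioi (0 : ℝ))), SobolevH.fn Ψ.1 (x + p) = Φ.fst p) ∧
      ∀ᵐ p ∂(volume.restrict (Set.Ioi (0 : ℝ))), SobolevH.fn Ψ.2 (x + p) = Φ.snd p := by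
  have m₁ := (SobolevH.memLp_fn Ψ.1).comp_measurePreserving (measurePreserving_add_Ioi x)
  have m₂ := (SobolevH.memLp_fn Ψ.2).comp_measurePreserving (measurePreserving_add_Ioi x)
  let ψ : PairL2 := WithLp.toLp 2 (m₁.toLp _, m₂.toLp _)
  have h₁ : ∀ᵐ p ∂(volume.restrict (Set.Ioi (0 : ℝ))), SobolevH.fn Ψ.1 (x + p) = ψ.fst p :=
    m₁.coeFn_toLp.symm
  have h₂ : ∀ᵐ p ∂(volume.restrict (Set.Ioi (0 : ℝ))), SobolevH.fn Ψ.2 (x + p) = ψ.snd p :=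
    m₂.coeFn_toLp.symm
  have hψ := (isMarchenkoSolution_iff hν hβ h₁ h₂).1 hΨ
  have hinj := (ContinuousLinearMap.isUnit_iff_bijective.1 hu).injective
  have : ψ = Φ := hinj (hψ.trans hΦ.symm)
  rw [← this]
  exact ⟨h₁, h₂⟩

end Equivalence

end Marchenko

/-! ### Choice of the threshold and conclusion -/

theorem proposition1 (N : ℕ) (hN : 1 ≤ N) (n : ℕ) (lam mu : Fin N → ℝ)
    (hlam : StrictMono lam) (hrange : ∀ k, -(1 / √2) < lam k ∧ lam k < 1 / √2)
    (hmu : ∀ k, mu k < 0) :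
    ∃ ε₀ : ℝ, 0 < ε₀ ∧ ∀ β : ℝ → ℂ,
      MemLp (fun l : ℝ => (l : ℂ) ^ (n + 2) * β l) ⊤ Marchenko.spectralMeasure →
      eLpNorm (fun l : ℝ => (l : ℂ) ^ n * β l) ⊤ Marchenko.spectralMeasure ≤ ENNReal.ofReal ε₀ →
      (∀ x : ℝ, ∃! Ψ : Marchenko.SobolevH n x × Marchenko.SobolevH n x,
        Marchenko.IsMarchenkoSolution lam mu β x
          (Marchenko.SobolevH.fn Ψ.1) (Marchenko.SobolevH.fn Ψ.2)) ∧
      ∀ Ψ : (x : ℝ) → Marchenko.SobolevH n x × Marchenko.SobolevH n x,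
        (∀ x, Marchenko.IsMarchenkoSolution lam mu β x
          (Marchenko.SobolevH.fn (Ψ x).1) (Marchenko.SobolevH.fn (Ψ x).2)) →
        ∀ k : ℕ, k < n →
          ∃ U : ℝ → Marchenko.SobolevH (n - k) 0 × Marchenko.SobolevH (n - k) 0,
            ContDiff ℝ k U ∧
            ∀ x : ℝ, ∀ᵐ p ∂(volume.restrict (Set.Ioi (0 : ℝ))),
              Marchenko.SobolevH.fn (U x).1 p = Marchenko.SobolevH.fn (Ψ x).1 (x + p) ∧
              Marchenko.SobolevH.fn (U x).2 p = Marchenko.SobolevH.fn (Ψ x).2 (x + p) := by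
  have hν : ∀ k, 0 < Marchenko.nuOf (lam k) := fun k =>
    Real.sqrt_pos.2 (Marchenko.one_half_sub_sq_pos (hrange k))
  have hs : (0 : ℝ) < √2 ^ n := by positivity
  have hε : (0 : ℝ) < 1 / (24 * √2 ^ n) := by positivity
  -- Since λ ≥ 1/√2, a bound ε₀ on |λⁿβ| bounds the off-diagonal symbols by 6 · √2ⁿ ε₀, which is 1/4
  -- for this choice; the diagonal symbol has 3 in place of 6.
  refine ⟨1 / (24 * √2 ^ n), hε, fun β hβ hsmall => ?_⟩
  have d₀ := Marchenko.symbolDecay_symbol₂ hβ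
  have dm := Marchenko.symbolDecay_symbolComb (σ := -Complex.I) (by simp) hβ
  have dp := Marchenko.symbolDecay_symbolComb (σ := Complex.I) (by simp) hβ
  have b₀ : ∀ᵐ η : ℝ, ‖Marchenko.symbol₂ β η‖ ≤ 1 / 4 := by
    filter_upwards [Marchenko.ae_norm_le_of_lamOf_bound
      ((Marchenko.ae_symbol_bounds hε.le hsmall).mono fun η h => h.2.1)] with η hη
    refine hη.trans ?_
    field_simp
    norm_num
  have bc : ∀ σ : ℂ, ‖σ‖ = 1 → ∀ᵐ η : ℝ, ‖Marchenko.symbolComb σ β η‖ ≤ 1 / 4 := by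
    intro σ hσ
    filter_upwards [Marchenko.ae_norm_le_of_lamOf_bound
      (Marchenko.ae_symbolComb_bound hσ hε.le hsmall)] with η hη
    refine hη.trans ?_
    field_simp
    norm_num
  have hu := Marchenko.isUnit_marchenkoOp hν (α := fun k => -mu k)
    (fun k => neg_nonneg.2 (hmu k).le)
    (fun k => Marchenko.conj_eigenPhase_mul_self (hrange k)) d₀ dm dp b₀
    (bc (-Complex.I) (by simp)) (bc Complex.I (by simp))
  refine ⟨fun x => ?_, fun Ψ hΨ k hk => ?_⟩
  -- For existence at a fixed x all n derivatives are spent on the variable p.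
  · obtain ⟨Φ, U, -, hΦ, hU⟩ := Marchenko.exists_sobolev_solution (m := n) (k := 0) hν hu d₀ dm dp
      le_rfl
    have e₁ : ∀ᵐ p ∂(volume.restrict (Set.Ioi (0 : ℝ))),
        Marchenko.SobolevH.fn (Marchenko.SobolevH.translate x (U x).1) (x + p) = (Φ x).fst p := by
      rw [← (hU x).1]; exact Marchenko.SobolevH.fn_translate_ae x (U x).1
    have e₂ : ∀ᵐ p ∂(volume.restrict (Set.Ioi (0 : ℝ))),
        Marchenko.SobolevH.fn (Marchenko.SobolevH.translate x (U x).2) (x + p) = (Φ x).snd p := by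
      rw [← (hU x).2]; exact Marchenko.SobolevH.fn_translate_ae x (U x).2
    refine ⟨(Marchenko.SobolevH.translate x (U x).1, Marchenko.SobolevH.translate x (U x).2),
      (Marchenko.isMarchenkoSolution_iff hν hβ e₁ e₂).2 (hΦ x), fun Ψ hΨ => ?_⟩
    obtain ⟨f₁, f₂⟩ := Marchenko.ae_eq_of_isMarchenkoSolution hν hβ (hu x) (hΦ x) hΨ
    refine Prod.ext ?_ ?_
    · refine Marchenko.SobolevH.ext_of_fn_ae ((Marchenko.ae_Ioi_comp_add_iff x _).1 ?_)
      filter_upwards [e₁, f₁] with p h h'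
      rw [h, h']
    · refine Marchenko.SobolevH.ext_of_fn_ae ((Marchenko.ae_Ioi_comp_add_iff x _).1 ?_)
      filter_upwards [e₂, f₂] with p h h'
      rw [h, h']
  -- Here k derivatives go to x and n - k to p. Uniqueness in L² identifies this curve with the
  -- given solutions.
  · obtain ⟨Φ, U, hUc, hΦ, hU⟩ := Marchenko.exists_sobolev_solution (m := n - k) (k := k) hν hu
      d₀ dm dp (by omega)
    refine ⟨U, hUc, fun x => ?_⟩
    obtain ⟨f₁, f₂⟩ := Marchenko.ae_eq_of_isMarchenkoSolution hν hβ (hu x) (hΦ x) (hΨ x)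
    filter_upwards [f₁, f₂] with p h h'
    rw [(hU x).1, (hU x).2, h, h']
    exact ⟨rfl, rfl⟩
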